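/- Conventions. Valuations are identified when they have the same valuation ring. For a valued field $(K,v)$ write $\mathcal O_v$ for the valuation ring, $vK$ for the (additive) value group, $Kv$ for the residue field. If $w$ is a valuation on $K$ and $\bar v$ a valuation on $Kw$, then $\bar v\circ w$ is the valuation on $K$ with valuation ring $\operatorname{res}_w^{-1}(\mathcal O_{\bar v})$, where $\operatorname{res}_w\colon\mathcal O_w\to Kw$ is the residue map. Valuations may be trivial. A finite extension $(K,v)\subseteq(L,v)$ of henselian valued fields is *defectless* if $[L:K]=(vL:vK)\,[Lv:Kv]$, and a *defect extension* otherwise; $(K,v)$ is *defectless* if all its finite extensions are. Let $(K,v)\subseteq(L,v)$ be a Galois defect extension whose degree is the prime $p=\operatorname{char}(Kv)>0$. For $\sigma\in\mathrm{Gal}(L/K)\setminus\{\mathrm{id}\}$ put $$\Sigma_\sigma=\left\{v\left(\frac{\sigma f-f}{f}\right)\;\middle|\; f\in L^\times\right\}\subseteq vL\cup\{\infty\}$$ (this set does not depend on $\sigma$, and $vL=vK$). The extension has *independent defect* if there is a proper, possibly trivial, convex subgroup $H\subsetneq vK$ such that $vK/H$ has no minimum positive element and $\Sigma_\sigma=\{\alpha\in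 vK\cup\{\infty\}\mid\alpha>H\}$ for every $\sigma\in\mathrm{Gal}(L/K)\setminus\{\mathrm{id}\}$. A henselian valued field $(K,v)$ of residue characteristic $p>0$ is an *independent defect field* if all Galois defect extensions of $(K',v)$ of degree $p$ have independent defect, where $K'=K(\zeta_p)$, with $\zeta_p$ a primitive $p$-th root of unity and with the unique extension of $v$, if $\operatorname{char}K=0$, and $K'=K$ otherwise. **Lemma.** Let $(K,v)$ be a henselian valued field with $v=\bar v\circ w$, such that $(K,w)$ is defectless, the field $Kw$ is perfect, and $(Kw,\bar v)$ is an independent defect field. Then $(K,v)$ is an independent defect field. -/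

import Mathlib

universe u

namespace DefectLemma

open IsLocalRing

/-- The composition `vbar ∘ w` of a valuation `w` on `K` and a valuation `vbar` on its residue field
`Kw`: its valuation ring is the preimage of `𝒪_vbar` under the residue map `𝒪_w → Kw`. -/
def compose {K : Type u} [Field K] (w : ValuationSubring K)
    (vbar : ValuationSubring (ResidueField w)) : ValuationSubring K :=
  ValuationSubring.ofSubring
    ((vbar.toSubring.comap (residue w)).map w.toSubring.subtype) (by
      intro x
      -- an element of `𝒪_w` whose residue is in `𝒪_vbar` lies in the composition
      have key : ∀ y : w, residue w y ∈ vbar →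
          (y : K) ∈ (vbar.toSubring.comap (residue w)).map w.toSubring.subtype :=
        fun y hy => ⟨y, hy, rfl⟩
      by_cases hx : x = 0
      · left
        rw [hx]
        exact Subring.zero_mem _
      -- it is enough to treat elements of `𝒪_w`
      have main : ∀ y : w, (y : K) ≠ 0 →
          (y : K) ∈ (vbar.toSubring.comap (residue w)).map w.toSubring.subtype ∨
          (y : K)⁻¹ ∈ (vbar.toSubring.comap (residue w)).map w.toSubring.subtype := by
        intro y hy0
        by_cases hu : IsUnit y
        · obtain ⟨t, rfl⟩ := hu
          have hinv : (((t⁻¹ : wˣ) : w) : K) = ((t : w) : K)⁻¹ := by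
            refine eq_inv_of_mul_eq_one_left ?_
            have h1 : ((t⁻¹ : wˣ) : w) * (t : w) = 1 := Units.inv_mul t
            exact congrArg (Subtype.val) h1
          have hres : residue w ((t⁻¹ : wˣ) : w) = (residue w (t : w))⁻¹ := by
            refine eq_inv_of_mul_eq_one_left ?_
            rw [← map_mul, Units.inv_mul, map_one]
          rcases vbar.mem_or_inv_mem (residue w (t : w)) with h | h
          · exact Or.inl (key _ h)
          · right
            rw [← hinv]
            exact key _ (by rw [hres]; exact h)
        · left
          refine key y ?_
          have h0 : residue w y = 0 := (residue_eq_zero_iff y).2 ((mem_maximalIdeal y).2 hu)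
          rw [h0]
          exact vbar.zero_mem
      rcases w.mem_or_inv_mem x with h | h
      · exact main ⟨x, h⟩ hx
      · have := main ⟨x⁻¹, h⟩ (inv_ne_zero hx)
        simp only [inv_inv] at this
        exact this.symm)

theorem mem_compose_iff {K : Type u} [Field K] (w : ValuationSubring K)
    (vbar : ValuationSubring (ResidueField w)) (x : K) :
    x ∈ compose w vbar ↔ ∃ h : x ∈ w, residue w ⟨x, h⟩ ∈ vbar := by
  constructor
  · rintro ⟨y, hy, rfl⟩
    exact ⟨y.2, hy⟩
  · rintro ⟨h, hy⟩
    exact ⟨⟨x, h⟩, hy, rfl⟩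

section Extension

variable {K L : Type u} [Field K] [Field L] [Algebra K L]

/-- `(K, v) ⊆ (L, vL)` is an extension of valued fields: `𝒪_vL ∩ K = 𝒪_v`. -/
def IsExtension (v : ValuationSubring K) (vL : ValuationSubring L) : Prop :=
  vL.comap (algebraMap K L) = v

variable {v : ValuationSubring K} {vL : ValuationSubring L}

theorem IsExtension.mem_iff (h : IsExtension v vL) (x : K) :
    algebraMap K L x ∈ vL ↔ x ∈ v := by
  rw [← h]
  exact Iff.rfl

/-- The inclusion of valuation rings `𝒪_v → 𝒪_vL`. -/
def integerMap (h : IsExtension v vL) : v →+* vL :=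
  ((algebraMap K L).comp v.subtype).codRestrict vL.toSubring
    (fun x => (h.mem_iff (x : K)).2 x.2)

theorem isLocalHom_integerMap (h : IsExtension v vL) : IsLocalHom (integerMap h) := by
  refine ⟨fun a ha => ?_⟩
  obtain ⟨b, hb⟩ := ha.exists_right_inv
  have hb' : algebraMap K L (a : K) * (b : L) = 1 := congrArg Subtype.val hb
  have ha0 : (a : K) ≠ 0 := by
    intro h0
    rw [h0, map_zero, zero_mul] at hb'
    exact zero_ne_one hb'
  have hinv : (a : K)⁻¹ ∈ v := by
    rw [← h.mem_iff, map_inv₀, inv_eq_of_mul_eq_one_right hb']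
    exact b.2
  exact IsUnit.of_mul_eq_one ⟨(a : K)⁻¹, hinv⟩ (Subtype.ext (mul_inv_cancel₀ ha0))

/-- The embedding of residue fields `Kv → LvL`. -/
noncomputable def residueMap (h : IsExtension v vL) : ResidueField v →+* ResidueField vL :=
  haveI := isLocalHom_integerMap h
  ResidueField.map (integerMap h)

/-- The residue degree `[LvL : Kv]`. -/
noncomputable def residueDegree (h : IsExtension v vL) : ℕ :=
  letI : Algebra (ResidueField v) (ResidueField vL) := (residueMap h).toAlgebra
  Module.finrank (ResidueField v) (ResidueField vL)

variable (K) in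
/-- The ramification index `(vL : vK)`: the index of the subgroup `{v(x) | x ∈ Kˣ}` in the value
group of `vL`. -/
noncomputable def ramificationIndex (vL : ValuationSubring L) : ℕ :=
  ((Units.map (vL.valuation : L →* vL.ValueGroup)).comp
    (Units.map (algebraMap K L : K →* L))).range.index

/-- The extension is defectless: `[L : K] = (vL : vK) [LvL : Kv]`. -/
def IsDefectlessExtension (h : IsExtension v vL) : Prop :=
  Module.finrank K L = ramificationIndex K vL * residueDegree h

/-- The set `Σ_σ = {v((σ f - f) / f) | f ∈ Lˣ}`, a subset of `vL ∪ {∞}`.  The type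
`vL.ValueGroup` is `vL ∪ {∞}` written multiplicatively, in the reversed order, with `∞` as `0`. -/
def sigmaSet (vL : ValuationSubring L) (σ : L ≃ₐ[K] L) : Set vL.ValueGroup :=
  {γ | ∃ f : L, f ≠ 0 ∧ γ = vL.valuation ((σ f - f) / f)}

variable (v vL) in
/-- Independent defect, for a Galois defect extension of prime degree.  The type `v.ValueGroupˣ` is
`vK`, written multiplicatively and with the reversed order; so `α > H` in additive notation reads
`∀ h ∈ H, α < h`.  The three conditions on the subgroup `H` before the last one say that it is
convex, that it is proper, and that `vK/H` has no minimum positive element: positive elements of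
`vK/H` are the cosets of the `γ > H`, and `γ + H ≤ δ + H` means `γ + h ≤ δ` for some `h ∈ H`.
The last condition is `Σ_σ = {α ∈ vK ∪ {∞} | α > H}`, where `α = v(x)`, `x ∈ K`, is regarded as an
element of `vL ∪ {∞}`. -/
def HasIndependentDefect : Prop :=
  ∃ H : Subgroup v.ValueGroupˣ,
    (H : Set v.ValueGroupˣ).OrdConnected ∧
    H ≠ ⊤ ∧
    (¬ ∃ γ : v.ValueGroupˣ, (∀ h ∈ H, γ < h) ∧
      ∀ δ : v.ValueGroupˣ, (∀ h ∈ H, δ < h) → ∃ h ∈ H, δ ≤ γ * h) ∧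
    ∀ σ : L ≃ₐ[K] L, σ ≠ 1 →
      sigmaSet vL σ = {α | ∃ x : K, (∀ h ∈ H, v.valuation x < (h : v.ValueGroup)) ∧
        α = vL.valuation (algebraMap K L x)}

end Extension

/-- `(K, v)` is defectless: all its finite extensions are defectless. -/
def IsDefectless {K : Type u} [Field K] (v : ValuationSubring K) : Prop :=
  ∀ (L : Type u) [Field L] [Algebra K L] [FiniteDimensional K L]
    (vL : ValuationSubring L) (h : IsExtension v vL), IsDefectlessExtension h

/-- All Galois defect extensions of `(K, v)` of degree `p` have independent defect. -/
def AllGaloisDefectIndependent {K : Type u} [Field K] (p : ℕ) (v : ValuationSubring K) : Prop :=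
  ∀ (L : Type u) [Field L] [Algebra K L] [FiniteDimensional K L] [IsGalois K L]
    (vL : ValuationSubring L) (h : IsExtension v vL),
    Module.finrank K L = p → ¬ IsDefectlessExtension h → HasIndependentDefect v vL

/-- `(K, v)` is an independent defect field: it is henselian of residue characteristic `p > 0`, and
all Galois defect extensions of degree `p` of `(K', v')` have independent defect, where
`K' = K(ζ_p)` with the valuation extending `v` if `K` has characteristic zero, and
`(K', v') = (K, v)` otherwise. -/
structure IsIndependentDefectField {K : Type u} [Field K] (v : ValuationSubring K) : Prop where
  henselian : HenselianLocalRing v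
  residueChar_ne_zero : ringChar (ResidueField v) ≠ 0
  independent_of_char_zero : ringChar K = 0 →
    ∀ (K' : Type u) [Field K'] [Algebra K K']
      [IsCyclotomicExtension {ringChar (ResidueField v)} K K'] (v' : ValuationSubring K'),
      IsExtension v v' → AllGaloisDefectIndependent (ringChar (ResidueField v)) v'
  independent_of_char_pos : ringChar K ≠ 0 →
    AllGaloisDefectIndependent (ringChar (ResidueField v)) v

end DefectLemma

/-!
Let `p = char Kv`, let `K'` be `K(ζ_p)` or `K`, with `v' = v̄' ∘ w'` extending `v = v̄ ∘ w`, and let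
`L | K'` be a Galois defect extension of degree `p`, with valuation `V = V̄ ∘ W`.

Since `v` is henselian, `Gal(L | K')` preserves `V` (`mem_iff_of_henselian`), so norms show that the
quotient of the value groups is killed by `p`.  By the fundamental inequality a defect extension of
prime degree therefore does not extend the value group (`exists_valuation_eq_of_defect`).  Hence `W`
is unramified over `w'`, and because `w'` is again defectless, the residue field extension
`LW | K'w'` has degree `p`.  As `K'w'` is perfect, traces and norms show that the Galois group acts
faithfully on `LW` (`residueEquiv_ne_one`), so that `LW | K'w'` is a Galois extension of degree `p`
with the same Galois group; it is a defect extension for `V̄`, since passing from `V` to `V̄`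
changes neither the residue degree nor the triviality of the value group extension.  If this residue
extension has independent defect, witnessed by a coarsening `O` of `v̄'`, then `O ∘ w'` witnesses
independent defect of `L | K'` (`HasIndependentDefect.compose`).

The residue extension has independent defect for one of two reasons.

* If `char Kw = 0`, then the conjugates of `ζ_p` stay distinct in the residue field, so
  `K'w' = Kw(ζ_p)` (`isCyclotomicExtension_residueField`), and the hypothesis on `v̄` applies.
* If `char Kw = p`, then `K'w'` is a perfect field of characteristic `p`, and all Galois defect
  extensions of degree `p` of such a field have independent defect
  (`hasIndependentDefect_of_perfect`).  Let `σ β = β + 1`.  Because of the `p`-th roots in the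
  ground field, the elements of absolute value less than `|β - c|` for all `c` in the ground field
  form a valuation ring (`distanceRing`).  Its maximal ideal contains all the `(σ f - f) / f`
  (`valuation_sub_div_lt_one`), and the quotients `1 / (β - c)` already have all the required
  nonzero values.
-/

namespace DefectLemma

open IsLocalRing

/-! ### Valuations on Galois extensions of henselian fields -/

section Henselian

open Polynomial
open scoped Pointwise

/-- The cyclotomic polynomial `1 - T + T²` has no root among the powers of `x` whose exponents are
sufficiently divisible: its roots are roots of unity, and `1` is not one of them. -/
theorem exists_pow_ne_root {F : Type*} [Field F] (x : F) :
    ∃ m : ℕ, 0 < m ∧ ∀ n : ℕ, 0 < n → m ∣ n → 1 - x ^ n + (x ^ n) ^ 2 ≠ 0 := by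
  by_cases h : IsOfFinOrder x
  · refine ⟨orderOf x, h.orderOf_pos, fun n _ hn => ?_⟩
    rw [orderOf_dvd_iff_pow_eq_one.1 hn]
    simp
  · refine ⟨1, one_pos, fun n hn _ h0 => h ?_⟩
    refine isOfFinOrder_iff_pow_eq_one.2 ⟨n * 6, by positivity, ?_⟩
    rw [pow_mul]
    linear_combination (x ^ n - 1) * (x ^ n + 1) * (x ^ n * x ^ n + x ^ n + 1) * h0

/-- A simultaneous approximation: an element lying in all the given valuation rings, congruent to
`1` wherever `u` has positive value, and to `0` wherever `u` has negative value. -/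
theorem exists_approx {N : Type*} [Field N] {ι : Type*} [Finite ι] (V : ι → ValuationSubring N)
    (u : N) : ∃ c : N, ∀ k, (V k).valuation c ≤ 1 ∧
      ((V k).valuation u < 1 → (V k).valuation (c - 1) < 1) ∧
      (1 < (V k).valuation u → (V k).valuation c < 1) := by
  classical
  cases nonempty_fintype ι
  have hm : ∀ k, ∃ m : ℕ, 0 < m ∧ ∀ n : ℕ, 0 < n → m ∣ n → (V k).valuation u ≤ 1 →
      (V k).valuation (1 - u ^ n + (u ^ n) ^ 2) = 1 := by
    intro k
    by_cases hu : (V k).valuation u ≤ 1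
    · have huV : u ∈ V k := ((V k).valuation_le_one_iff u).1 hu
      obtain ⟨m, hm0, hm⟩ := exists_pow_ne_root (residue (V k) ⟨u, huV⟩)
      refine ⟨m, hm0, fun n hn hmn _ => ?_⟩
      have h1 := hm n hn hmn
      have h2 : residue (V k) (1 - ⟨u, huV⟩ ^ n + (⟨u, huV⟩ ^ n) ^ 2) ≠ 0 := by
        rw [map_add, map_sub, map_one, map_pow, map_pow, map_pow]
        exact h1
      have h3 := residue_ne_zero_iff_isUnit _ |>.1 h2
      exact ((V k).valuation_eq_one_iff _).1 h3
    · exact ⟨1, one_pos, fun n _ _ h => absurd h hu⟩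
  choose m hm0 hm using hm
  set n := ∏ k, m k with hn
  have hn0 : 0 < n := Finset.prod_pos fun k _ => hm0 k
  refine ⟨(1 - u ^ n + (u ^ n) ^ 2)⁻¹, fun k => ?_⟩
  have hk := hm k n hn0 (Finset.dvd_prod_of_mem _ (Finset.mem_univ k))
  rcases le_or_gt ((V k).valuation u) 1 with hu | hu
  · have h1 := hk hu
    refine ⟨by rw [map_inv₀, h1, inv_one], fun hlt => ?_, fun h => absurd hu h.not_ge⟩
    have hne : (1 - u ^ n + (u ^ n) ^ 2) ≠ 0 := by
      intro h0; rw [h0, map_zero] at h1; exact zero_ne_one h1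
    have e : (1 - u ^ n + (u ^ n) ^ 2)⁻¹ - 1 =
        (u ^ n * (1 - u ^ n)) * (1 - u ^ n + (u ^ n) ^ 2)⁻¹ := by
      field_simp; ring
    have hp : (V k).valuation (u ^ n) < 1 := by
      rw [map_pow]; exact pow_lt_one₀ zero_le hlt hn0.ne'
    rw [e, map_mul, map_mul, map_inv₀, h1, (V k).valuation.map_one_sub_of_lt hp]
    simpa using hp
  · have hp : 1 < (V k).valuation (u ^ n) := by
      rw [map_pow]; exact one_lt_pow₀ hu hn0.ne'
    have h2 : (V k).valuation (u ^ n) < (V k).valuation ((u ^ n) ^ 2) := by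
      rw [map_pow _ (u ^ n), sq]
      exact lt_mul_of_one_lt_left (zero_lt_one.trans hp) hp
    have h3 : (V k).valuation (1 - u ^ n) < (V k).valuation ((u ^ n) ^ 2) :=
      ((V k).valuation.map_sub_lt (by rw [map_one]; exact hp.trans h2) h2)
    have h4 : (V k).valuation (1 - u ^ n + (u ^ n) ^ 2)⁻¹ < 1 := by
      rw [map_inv₀, (V k).valuation.map_add_eq_of_lt_right h3]
      exact inv_lt_one_of_one_lt₀ (hp.trans h2)
    exact ⟨h4.le, fun h => absurd h (not_lt.2 hu.le), fun _ => h4⟩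

/-- Two distinct conjugates of a valuation ring under a finite group are incomparable. -/
theorem smul_eq_of_smul_le {N G : Type*} [Field N] [Group G] [Finite G] [MulSemiringAction G N]
    (V : ValuationSubring N) (g : G) (h : g • V ≤ V) : g • V = V := by
  have hpow : ∀ n : ℕ, g ^ n • V ≤ V := by
    intro n
    induction n with
    | zero => simp
    | succ n ih =>
      rw [pow_succ, mul_smul]
      exact (ValuationSubring.pointwise_smul_le_pointwise_smul_iff.2 h).trans ih
  refine le_antisymm h ?_
  rw [ValuationSubring.subset_pointwise_smul_iff]
  have : g⁻¹ ∈ Submonoid.powers g := by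
    rw [(isOfFinOrder_of_finite g).mem_powers_iff_mem_zpowers]
    exact inv_mem (Subgroup.mem_zpowers g)
  obtain ⟨n, hn⟩ := this
  rw [← hn]
  exact hpow n

theorem valuation_lt_one_iff_or {N : Type*} [Field N] (V : ValuationSubring N) (x : N) :
    V.valuation x < 1 ↔ x = 0 ∨ x⁻¹ ∉ V :=
  V.mem_nonunits_iff_or

theorem smul_valuation_lt_one_iff {N G : Type*} [Field N] [Group G] [MulSemiringAction G N]
    (V : ValuationSubring N) (g : G) (x : N) :
    (g • V).valuation x < 1 ↔ V.valuation (g⁻¹ • x) < 1 := by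
  rw [valuation_lt_one_iff_or, valuation_lt_one_iff_or,
    ValuationSubring.mem_pointwise_smul_iff_inv_smul_mem, smul_inv'', smul_eq_zero_iff_eq]

theorem smul_valuation_le_one_iff {N G : Type*} [Field N] [Group G] [MulSemiringAction G N]
    (V : ValuationSubring N) (g : G) (x : N) :
    (g • V).valuation x ≤ 1 ↔ V.valuation (g⁻¹ • x) ≤ 1 := by
  rw [ValuationSubring.valuation_le_one_iff, ValuationSubring.valuation_le_one_iff,
    ValuationSubring.mem_pointwise_smul_iff_inv_smul_mem]

/-- An element of the decomposition field which is congruent to `1` at `V` and to `0` at every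
other conjugate of `V`. -/
theorem exists_decomposition_approx {N G : Type*} [Field N] [Group G] [Finite G]
    [MulSemiringAction G N] (V : ValuationSubring N) :
    ∃ a : N, V.valuation (a - 1) < 1 ∧ (∀ d : G, d • V = V → d • a = a) ∧
      ∀ g : G, g • V ≠ V → V.valuation (g • a) < 1 := by
  classical
  cases nonempty_fintype G
  have h1 : ∀ g : G, ∃ c : N, (∀ k : G, (k • V).valuation c ≤ 1) ∧
      (g • V ≠ V → V.valuation (c - 1) < 1 ∧ (g • V).valuation c < 1) := by
    intro g
    by_cases hg : g • V = V
    · exact ⟨0, by simp, fun h => absurd hg h⟩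
    have hn1 : ¬ V ≤ g • V := by
      intro h
      rw [ValuationSubring.subset_pointwise_smul_iff] at h
      exact hg (eq_inv_smul_iff.1 (smul_eq_of_smul_le V g⁻¹ h).symm)
    have hn2 : ¬ g • V ≤ V := fun h => hg (smul_eq_of_smul_le V g h)
    obtain ⟨x, hx1, hx2⟩ := SetLike.not_le_iff_exists.1 hn1
    obtain ⟨y, hy1, hy2⟩ := SetLike.not_le_iff_exists.1 hn2
    have hy0 : y ≠ 0 := fun h => hy2 (h ▸ V.zero_mem)
    rw [← ValuationSubring.valuation_le_one_iff] at hx1 hx2 hy1 hy2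
    push Not at hx2 hy2
    obtain ⟨c, hc⟩ := exists_approx (fun k : G => k • V) (x / y)
    refine ⟨c, fun k => (hc k).1, fun _ => ⟨?_, (hc g).2.2 ?_⟩⟩
    · have h := (hc 1).2.1
      rw [smul_valuation_lt_one_iff, smul_valuation_lt_one_iff, inv_one, one_smul, one_smul] at h
      apply h
      rw [map_div₀]
      exact (div_lt_one₀ (zero_lt_one.trans hy2)).2 (hx1.trans_lt hy2)
    · rw [map_div₀]
      exact (one_lt_div₀ ((g • V).valuation.pos_iff.2 hy0)).2 (hy1.trans_lt hx2)
  choose c hc1 hc2 using h1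
  -- products of elements congruent to `1` are congruent to `1`
  have hprod1 : ∀ (s : Finset G) (f : G → N), (∀ g ∈ s, V.valuation (f g - 1) < 1) →
      V.valuation (∏ g ∈ s, f g - 1) < 1 := by
    intro s f
    induction s using Finset.induction_on with
    | empty => simp
    | insert i s hi ih =>
      intro h
      rw [Finset.prod_insert hi]
      have e : f i * ∏ g ∈ s, f g - 1 = (f i - 1) * (∏ g ∈ s, f g - 1) + (f i - 1) +
        (∏ g ∈ s, f g - 1) := by ring
      have hA := h i (Finset.mem_insert_self i s)
      have hB := ih fun g hg => h g (Finset.mem_insert_of_mem hg)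
      rw [e]
      refine V.valuation.map_add_lt (V.valuation.map_add_lt ?_ hA) hB
      rw [map_mul]
      exact mul_lt_one_of_nonneg_of_lt_one_left zero_le hA hB.le
  let S : Finset G := Finset.univ.filter fun g => g • V ≠ V
  let b : N := ∏ g ∈ S, c g
  have hb1 : V.valuation (b - 1) < 1 :=
    hprod1 S c fun g hg => (hc2 g (Finset.mem_filter.1 hg).2).1
  have hb2 : ∀ k : G, (k • V).valuation b ≤ 1 := fun k => by
    rw [map_prod]
    exact Finset.prod_le_one (fun _ _ => zero_le) fun g _ => hc1 g k
  have hb3 : ∀ g : G, g • V ≠ V → (g • V).valuation b < 1 := fun g hg => by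
    have hgS : g ∈ S := Finset.mem_filter.2 ⟨Finset.mem_univ _, hg⟩
    have e : b = c g * ∏ k ∈ S.erase g, c k := (Finset.mul_prod_erase S c hgS).symm
    rw [e, map_mul, map_prod]
    exact mul_lt_one_of_nonneg_of_lt_one_left zero_le (hc2 g hg).2
      (Finset.prod_le_one (fun _ _ => zero_le) fun k _ => hc1 k g)
  let D : Finset G := Finset.univ.filter fun g => g • V = V
  refine ⟨∏ d ∈ D, d • b, ?_, fun d hd => ?_, fun g hg => ?_⟩
  · refine hprod1 D _ fun d hd => ?_
    have hd : d • V = V := (Finset.mem_filter.1 hd).2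
    have e : d • b - 1 = d • (b - 1) := by rw [smul_sub, smul_one]
    have h2 := smul_valuation_lt_one_iff V d⁻¹ (b - 1)
    rw [inv_inv, inv_smul_eq_iff.2 hd.symm] at h2
    rw [e, ← h2]
    exact hb1
  · rw [Finset.smul_prod']
    refine Finset.prod_bij (fun k _ => d * k) ?_ ?_ ?_ ?_
    · intro k hk
      simp only [D, Finset.mem_filter, Finset.mem_univ, true_and] at hk ⊢
      rw [mul_smul, hk, hd]
    · intro k _ l _ h
      exact mul_left_cancel h
    · intro k hk
      simp only [D, Finset.mem_filter, Finset.mem_univ, true_and] at hk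
      refine ⟨d⁻¹ * k, ?_, by simp⟩
      simp only [D, Finset.mem_filter, Finset.mem_univ, true_and]
      rw [mul_smul, hk, inv_smul_eq_iff, hd]
    · intro k _
      rw [mul_smul]
  · have h1D : (1 : G) ∈ D := by simp [D]
    rw [Finset.smul_prod', ← Finset.mul_prod_erase D _ h1D, one_smul, map_mul, map_prod]
    have key : ∀ k : G, V.valuation (k • b) ≤ 1 := fun k => by
      have := (smul_valuation_le_one_iff V k⁻¹ b).1 (hb2 _)
      rwa [inv_inv] at this
    refine mul_lt_one_of_nonneg_of_lt_one_left zero_le ?_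
      (Finset.prod_le_one (fun _ _ => zero_le) fun k _ => ?_)
    · have := (smul_valuation_lt_one_iff V g⁻¹ b).1 (hb3 _ fun h => hg (inv_smul_eq_iff.1 h).symm)
      rwa [inv_inv] at this
    · rw [← mul_smul]; exact key _

theorem IsExtension.valuation_le_one_iff {K L : Type u} [Field K] [Field L] [Algebra K L]
    {v : ValuationSubring K} {V : ValuationSubring L} (h : IsExtension v V) (x : K) :
    V.valuation (algebraMap K L x) ≤ 1 ↔ v.valuation x ≤ 1 := by
  rw [ValuationSubring.valuation_le_one_iff, ValuationSubring.valuation_le_one_iff, h.mem_iff]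

theorem IsExtension.valuation_lt_one_iff {K L : Type u} [Field K] [Field L] [Algebra K L]
    {v : ValuationSubring K} {V : ValuationSubring L} (h : IsExtension v V) (x : K) :
    V.valuation (algebraMap K L x) < 1 ↔ v.valuation x < 1 := by
  rw [valuation_lt_one_iff_or, valuation_lt_one_iff_or, ← map_inv₀, h.mem_iff, map_eq_zero]

/-- The decomposition group of a valuation on a Galois extension of a henselian field is everything.
Otherwise, the minimal polynomial of an element of the decomposition field which is congruent to `1`
at `V` and to `0` at all other conjugates would reduce to `X ^ (r - 1) * (X - 1)`, and have a root
in `K` by Hensel's lemma. -/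
theorem smul_eq_of_henselian {K N : Type u} [Field K] [Field N] [Algebra K N]
    [FiniteDimensional K N] [IsGalois K N] {v : ValuationSubring K} {V : ValuationSubring N}
    (hv : HenselianLocalRing v) (h : IsExtension v V) (g : N ≃ₐ[K] N) : g • V = V := by
  classical
  by_contra hg
  obtain ⟨a, ha1, haD, haG⟩ := exists_decomposition_approx (G := N ≃ₐ[K] N) V
  have haV : V.valuation a = 1 := by
    have := V.valuation.map_one_add_of_lt ha1
    rwa [add_sub_cancel] at this
  have hint : IsIntegral K a := Algebra.IsIntegral.isIntegral a
  -- the roots of the minimal polynomial are the conjugates of `a`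
  have hconj : ∀ r : N, aeval r (minpoly K a) = 0 → r = a ∨ V.valuation r < 1 := by
    intro r hr
    obtain ⟨s, rfl⟩ := minpoly.exists_algEquiv_of_root' hint.isAlgebraic hr
    by_cases hs : s • V = V
    · exact Or.inl (haD s hs)
    · exact Or.inr (haG s hs)
  set F : N[X] := (minpoly K a).map (algebraMap K N) with hF
  have hFm : F.Monic := (minpoly.monic hint).map _
  have hroot : ∀ r ∈ F.roots, r = a ∨ V.valuation r < 1 := by
    intro r hr
    refine hconj r ?_
    have := (mem_roots hFm.ne_zero).1 hr
    rwa [hF, IsRoot, eval_map_algebraMap] at this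
  have hrootle : ∀ r ∈ F.roots, V.valuation r ≤ 1 := fun r hr => by
    rcases hroot r hr with rfl | h
    exacts [haV.le, h.le]
  have hamem : a ∈ F.roots := by
    rw [mem_roots hFm.ne_zero, hF, IsRoot, eval_map_algebraMap, minpoly.aeval]
  have hnodup : F.roots.Nodup :=
    nodup_roots (Separable.map (Algebra.IsSeparable.isSeparable K a))
  have hprod : F = (F.roots.map fun r => X - C r).prod :=
    ((Normal.splits (F := K) inferInstance a).eq_prod_roots_of_monic hFm)
  have hlift : ∀ s : Multiset N, (∀ r ∈ s, V.valuation r ≤ 1) →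
      (s.map fun r => X - C r).prod ∈ lifts V.subtype := by
    intro s hs
    refine Subsemiring.multiset_prod_mem _ _ fun q hq => ?_
    obtain ⟨r, hr, rfl⟩ := Multiset.mem_map.1 hq
    refine ⟨X - C ⟨r, (V.valuation_le_one_iff r).1 (hs r hr)⟩, ?_⟩
    simp
  have heval : ∀ q ∈ lifts V.subtype, V.valuation (q.eval 1) ≤ 1 := by
    rintro _ ⟨q, rfl⟩
    rw [coe_mapRingHom, eval_map, ← map_one V.subtype, eval₂_at_apply]
    exact (V.valuation_le_one_iff _).2 (q.eval 1).2
  -- `F` has coefficients in `𝒪_v`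
  have hFv : minpoly K a ∈ lifts v.subtype := by
    rw [lifts_iff_coeff_lifts]
    intro n
    obtain ⟨q, hq⟩ := hlift F.roots hrootle
    rw [coe_mapRingHom, ← hprod] at hq
    refine ⟨⟨(minpoly K a).coeff n, ?_⟩, rfl⟩
    rw [← h.mem_iff, ← coeff_map, ← hF, ← hq, coeff_map]
    exact (q.coeff n).2
  obtain ⟨f, hf, -, hfm⟩ := lifts_and_natDegree_eq_and_monic hFv (minpoly.monic hint)
  have hmapeval : ∀ q : v[X], algebraMap K N ((q.eval 1 : v) : K) =
      ((q.map v.subtype).map (algebraMap K N)).eval 1 := by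
    intro q
    rw [map_map, eval_map, ← map_one ((algebraMap K N).comp v.subtype), eval₂_at_apply]
    rfl
  set Q : N[X] := ((F.roots.erase a).map fun r => X - C r).prod with hQ
  have hFQ : F = (X - C a) * Q := by
    rw [hQ]
    conv_lhs => rw [hprod, ← Multiset.cons_erase hamem, Multiset.map_cons, Multiset.prod_cons]
  have h1a : V.valuation (1 - a) < 1 := by rwa [Valuation.map_sub_swap]
  have hQle : Q ∈ lifts V.subtype := hlift _ fun r hr => hrootle r (Multiset.mem_of_mem_erase hr)
  have hQ1 : V.valuation (Q.eval 1) = 1 := by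
    rw [hQ, eval_multiset_prod, map_multiset_prod, Multiset.map_map, Multiset.map_map]
    refine Multiset.prod_eq_one fun x hx => ?_
    obtain ⟨r, hr, rfl⟩ := Multiset.mem_map.1 hx
    have hr' := (hnodup.mem_erase_iff.1 hr)
    have := V.valuation.map_one_sub_of_lt ((hroot r hr'.2).resolve_left hr'.1)
    simpa using this
  obtain ⟨z, hz, -⟩ := hv.is_henselian f hfm 1 (by
      rw [ValuationSubring.valuation_lt_one_iff, ← h.valuation_lt_one_iff, hmapeval, hf, ← hF, hFQ,
        eval_mul, map_mul]
      refine mul_lt_one_of_nonneg_of_lt_one_left zero_le ?_ (heval Q hQle)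
      simpa using h1a) (by
      rw [ValuationSubring.valuation_eq_one_iff]
      have e : algebraMap K N ((f.derivative.eval 1 : v) : K) =
          Q.eval 1 + (1 - a) * Q.derivative.eval 1 := by
        rw [hmapeval, ← derivative_map, hf, ← derivative_map, ← hF, hFQ]
        simp
      have hlt : V.valuation ((1 - a) * Q.derivative.eval 1) < 1 := by
        rw [map_mul]
        refine mul_lt_one_of_nonneg_of_lt_one_left zero_le h1a ?_
        obtain ⟨q, hq⟩ := hQle
        exact heval _ ⟨derivative q, by rw [← hq]; simp [derivative_map]⟩
      have hone : V.valuation (algebraMap K N ((f.derivative.eval 1 : v) : K)) = 1 := by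
        rw [e, V.valuation.map_add_eq_of_lt_left (by rwa [hQ1]), hQ1]
      refine le_antisymm ((h.valuation_le_one_iff _).1 hone.le) (not_lt.1 fun hc => ?_)
      exact ((h.valuation_lt_one_iff _).2 hc).ne hone)
  have hz' : aeval (algebraMap K N (z : K)) (minpoly K a) = 0 := by
    rw [aeval_algebraMap_apply, ← hf, coe_aeval_eq_eval, eval_map]
    have : eval₂ v.subtype (v.subtype z) f = v.subtype (f.eval z) := eval₂_at_apply _ _
    rw [show (z : K) = v.subtype z from rfl, this, hz]
    simp
  obtain ⟨s, hs⟩ := minpoly.exists_algEquiv_of_root' hint.isAlgebraic hz'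
  have hga : g a = a := by
    have : a = algebraMap K N (z : K) := by
      rw [← s.symm_apply_apply a, hs, AlgEquiv.commutes]
    rw [this, AlgEquiv.commutes]
  have := haG g hg
  rw [AlgEquiv.smul_def, hga] at this
  exact this.ne haV

theorem exists_isExtension {L N : Type u} [Field L] [Field N] [Algebra L N]
    (V : ValuationSubring L) : ∃ W : ValuationSubring N, IsExtension V W := by
  have : IsLocalRing V.toSubring := V.isLocalRing
  obtain ⟨W, hW, hm⟩ := Ideal.image_subset_nonunits_valuationSubring
    (maximalIdeal (V.toSubring.map (algebraMap L N))) (maximalIdeal.isMaximal _).ne_top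
  refine ⟨W, ValuationSubring.ext _ _ fun x => ⟨fun hx => ?_, fun hx => hW ⟨x, hx, rfl⟩⟩⟩
  by_contra hxV
  have hx' : x⁻¹ ∈ V := (V.mem_or_inv_mem x).resolve_left hxV
  have hx0 : x ≠ 0 := fun h => hxV (h ▸ V.zero_mem)
  let y : V.toSubring.map (algebraMap L N) := ⟨algebraMap L N x⁻¹, x⁻¹, hx', rfl⟩
  have hy : y ∈ maximalIdeal (V.toSubring.map (algebraMap L N)) := by
    rw [mem_maximalIdeal, mem_nonunits_iff]
    intro hu
    obtain ⟨⟨_, c, hc, rfl⟩, hb⟩ := hu.exists_right_inv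
    have hb' : algebraMap L N x⁻¹ * algebraMap L N c = 1 := congrArg Subtype.val hb
    rw [← map_mul, map_eq_one_iff _ (algebraMap L N).injective, inv_mul_eq_one₀ hx0] at hb'
    exact hxV (hb' ▸ hc)
  have h1 : (y : N) ∈ W.nonunits := hm ⟨y, hy, rfl⟩
  have hy' : (y : N) = (algebraMap L N x)⁻¹ := map_inv₀ _ _
  rw [hy', ValuationSubring.inv_mem_nonunits_iff] at h1
  exact h1.elim (fun h => hx0 ((map_eq_zero _).1 h)) fun h => h hx

theorem IsExtension.trans {K L N : Type u} [Field K] [Field L] [Field N] [Algebra K L]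
    [Algebra L N] [Algebra K N] [IsScalarTower K L N] {v : ValuationSubring K}
    {V : ValuationSubring L} {W : ValuationSubring N} (h₁ : IsExtension v V)
    (h₂ : IsExtension V W) : IsExtension v W :=
  ValuationSubring.ext _ _ fun x => by
    rw [ValuationSubring.mem_comap, IsScalarTower.algebraMap_apply K L N, h₂.mem_iff, h₁.mem_iff]

/-- Valuations on finite separable extensions of a henselian field are invariant under
automorphisms. -/
theorem mem_iff_of_henselian {K L : Type u} [Field K] [Field L] [Algebra K L]
    [FiniteDimensional K L] [Algebra.IsSeparable K L] {v : ValuationSubring K}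
    {V : ValuationSubring L} (hv : HenselianLocalRing v) (h : IsExtension v V) (g : L ≃ₐ[K] L)
    (x : L) : g x ∈ V ↔ x ∈ V := by
  let N := IntermediateField.normalClosure K L (AlgebraicClosure L)
  have hsep : Algebra.IsSeparable K N := by
    refine (le_separableClosure_iff K (AlgebraicClosure L) N).1
      (normalClosure_le_iff.2 fun f => ?_)
    have : Algebra.IsSeparable K f.fieldRange :=
      (AlgEquiv.Algebra.isSeparable_iff (AlgEquiv.ofInjectiveField f)).1 inferInstance
    exact le_separableClosure K (AlgebraicClosure L) f.fieldRange
  have : IsGalois K N := ⟨⟩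
  obtain ⟨W, hW⟩ := exists_isExtension (N := N) V
  have hg := smul_eq_of_henselian hv (h.trans hW) (g.liftNormal N)
  rw [← hW.mem_iff, ← hW.mem_iff, ← AlgEquiv.liftNormal_commutes, ← AlgEquiv.smul_def]
  conv_lhs => rw [← hg]
  exact ValuationSubring.smul_mem_pointwise_smul_iff

end Henselian

/-! ### Ramification index and residue degree -/

section Basic

variable {K L : Type u} [Field K] [Field L] [Algebra K L] {v : ValuationSubring K}
  {V : ValuationSubring L}

theorem IsExtension.isEquiv (h : IsExtension v V) :
    (V.valuation.comap (algebraMap K L)).IsEquiv v.valuation :=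
  Valuation.isEquiv_of_val_le_one fun {x} => h.valuation_le_one_iff x

theorem IsExtension.valuation_le_iff (h : IsExtension v V) (x y : K) :
    V.valuation (algebraMap K L x) ≤ V.valuation (algebraMap K L y) ↔
      v.valuation x ≤ v.valuation y :=
  h.isEquiv x y

theorem IsExtension.valuation_eq_iff (h : IsExtension v V) (x y : K) :
    V.valuation (algebraMap K L x) = V.valuation (algebraMap K L y) ↔
      v.valuation x = v.valuation y := by
  rw [le_antisymm_iff, h.valuation_le_iff, h.valuation_le_iff, ← le_antisymm_iff]

variable (K) in
/-- The group of the elements of `Lˣ` which have the same value as an element of `K`.  Its index in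
`Lˣ` is the ramification index. -/
noncomputable def valueSubgroup (V : ValuationSubring L) : Subgroup Lˣ :=
  ((Units.map (V.valuation : L →* V.ValueGroup)).comp
    (Units.map (algebraMap K L : K →* L))).range.comap (Units.map (V.valuation : L →* V.ValueGroup))

theorem mem_valueSubgroup_iff (x : Lˣ) :
    x ∈ valueSubgroup K V ↔ ∃ k : K, V.valuation (x : L) = V.valuation (algebraMap K L k) := by
  constructor
  · rintro ⟨k, hk⟩
    exact ⟨k, (congrArg Units.val hk).symm⟩
  · rintro ⟨k, hk⟩
    have hk0 : k ≠ 0 := by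
      rintro rfl
      rw [map_zero, map_zero, map_eq_zero] at hk
      exact x.ne_zero hk
    exact ⟨Units.mk0 k hk0, Units.ext hk.symm⟩

theorem units_map_valuation_surjective (V : ValuationSubring L) :
    Function.Surjective (Units.map (V.valuation : L →* V.ValueGroup)) := by
  intro γ
  obtain ⟨x, hx⟩ := V.valuation_surjective γ
  have hx0 : x ≠ 0 := by
    rintro rfl
    rw [map_zero] at hx
    exact γ.ne_zero hx.symm
  exact ⟨Units.mk0 x hx0, Units.ext hx⟩

theorem ramificationIndex_eq_index : ramificationIndex K V = (valueSubgroup K V).index :=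
  (Subgroup.index_comap_of_surjective _ (units_map_valuation_surjective V)).symm

theorem ramificationIndex_eq_one_iff :
    ramificationIndex K V = 1 ↔
      ∀ x : L, ∃ k : K, V.valuation x = V.valuation (algebraMap K L k) := by
  rw [ramificationIndex_eq_index, Subgroup.index_eq_one, Subgroup.eq_top_iff']
  refine ⟨fun h x => ?_, fun h x => mem_valueSubgroup_iff x |>.2 (h x)⟩
  by_cases hx : x = 0
  · exact ⟨0, by rw [hx, map_zero, map_zero, map_zero]⟩
  · exact (mem_valueSubgroup_iff (Units.mk0 x hx)).1 (h _)

theorem residueMap_residue (h : IsExtension v V) (x : v) :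
    residueMap h (residue v x) = residue V ⟨algebraMap K L x, (h.mem_iff _).2 x.2⟩ :=
  rfl

end Basic

section Tower

variable {K L N : Type u} [Field K] [Field L] [Field N] [Algebra K L]
    [Algebra L N] [Algebra K N] [IsScalarTower K L N] {v : ValuationSubring K}
    {V : ValuationSubring L} {W : ValuationSubring N}

theorem ramificationIndex_mul (h₂ : IsExtension V W) :
    ramificationIndex K V * ramificationIndex L W = ramificationIndex K W := by
  rw [ramificationIndex_eq_index (K := L), ramificationIndex_eq_index (K := K) (V := W)]
  have hle : valueSubgroup K W ≤ valueSubgroup L W := fun x hx => by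
    obtain ⟨k, hk⟩ := (mem_valueSubgroup_iff x).1 hx
    exact (mem_valueSubgroup_iff x).2 ⟨algebraMap K L k, by
      rw [hk, IsScalarTower.algebraMap_apply K L N]⟩
  rw [← Subgroup.relIndex_mul_index hle]
  congr 1
  have e1 : valueSubgroup K V =
      (valueSubgroup K W).comap (Units.map (algebraMap L N : L →* N)) := by
    ext x
    rw [Subgroup.mem_comap, mem_valueSubgroup_iff, mem_valueSubgroup_iff]
    refine exists_congr fun k => ?_
    rw [← h₂.valuation_eq_iff, ← IsScalarTower.algebraMap_apply]
    rfl
  rw [ramificationIndex_eq_index, e1, Subgroup.index_comap]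
  -- the units coming from `L` and `valueSubgroup L W` have the same image in the value group
  set φ := Units.map (W.valuation : N →* W.ValueGroup)
  have e2 : valueSubgroup K W = ((valueSubgroup K W).map φ).comap φ := by
    rw [Subgroup.comap_map_eq]
    refine (sup_of_le_left fun x hx => ?_).symm
    refine (mem_valueSubgroup_iff x).2 ⟨1, ?_⟩
    rw [map_one, map_one]
    exact congrArg Units.val hx
  rw [e2, Subgroup.relIndex_comap, Subgroup.relIndex_comap]
  congr 1
  apply le_antisymm
  · rintro _ ⟨_, ⟨x, rfl⟩, rfl⟩
    exact ⟨_, (mem_valueSubgroup_iff _).2 ⟨(x : L), rfl⟩, rfl⟩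
  · rintro _ ⟨x, hx, rfl⟩
    obtain ⟨k, hk⟩ := (mem_valueSubgroup_iff _).1 hx
    have hk0 : k ≠ 0 := by
      rintro rfl
      rw [map_zero, map_zero, map_eq_zero] at hk
      exact x.ne_zero hk
    exact ⟨_, ⟨Units.mk0 k hk0, rfl⟩, Units.ext hk.symm⟩

theorem residueDegree_mul (h₁ : IsExtension v V) (h₂ : IsExtension V W) :
    residueDegree h₁ * residueDegree h₂ = residueDegree (h₁.trans h₂) := by
  let : Algebra (ResidueField v) (ResidueField V) := (residueMap h₁).toAlgebra
  let : Algebra (ResidueField V) (ResidueField W) := (residueMap h₂).toAlgebra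
  let : Algebra (ResidueField v) (ResidueField W) := (residueMap (h₁.trans h₂)).toAlgebra
  have : IsScalarTower (ResidueField v) (ResidueField V) (ResidueField W) := by
    refine IsScalarTower.of_algebraMap_eq fun x => ?_
    obtain ⟨x, rfl⟩ := residue_surjective x
    change residueMap _ _ = residueMap _ (residueMap _ _)
    rw [residueMap_residue, residueMap_residue, residueMap_residue]
    congr 2
    exact IsScalarTower.algebraMap_apply K L N _
  exact Module.finrank_mul_finrank (ResidueField v) (ResidueField V) (ResidueField W)

end Tower

/-- Finite extensions of defectless fields are defectless. -/
theorem IsDefectless.of_finite {K K' : Type u} [Field K] [Field K'] [Algebra K K']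
    [FiniteDimensional K K'] {w : ValuationSubring K} {w' : ValuationSubring K'}
    (h : IsExtension w w') (hw : IsDefectless w) : IsDefectless w' := by
  intro L _ _ _ wL hL
  let : Algebra K L := ((algebraMap K' L).comp (algebraMap K K')).toAlgebra
  have : IsScalarTower K K' L := IsScalarTower.of_algebraMap_eq fun _ => rfl
  have : FiniteDimensional K L := FiniteDimensional.trans K K' L
  have h1 : _ = _ := hw K' w' h
  have h2 : _ = _ := hw L wL (h.trans hL)
  rw [← Module.finrank_mul_finrank K K' L, h1, ← ramificationIndex_mul (K := K) hL,
    ← residueDegree_mul h hL, mul_mul_mul_comm] at h2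
  refine mul_left_cancel₀ ?_ h2
  rw [← h1]
  exact Module.finrank_pos.ne'

section Inequality

variable {K L : Type u} [Field K] [Field L] [Algebra K L] {v : ValuationSubring K}
  {V : ValuationSubring L}

/-- A linear combination of elements with linearly independent residues takes its value in the
value group of the ground field. -/
theorem exists_valuation_sum_eq {ι : Type*} [Fintype ι] (h : IsExtension v V) (s : ι → V)
    (hs : letI := (residueMap h).toAlgebra
      LinearIndependent (ResidueField v) fun i => residue V (s i)) (c : ι → K) (hc : c ≠ 0) :
    ∃ k : K, k ≠ 0 ∧
      V.valuation (∑ i, algebraMap K L (c i) * (s i : L)) = V.valuation (algebraMap K L k) := by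
  let := (residueMap h).toAlgebra
  obtain ⟨i₁, hi₁⟩ := Function.ne_iff.1 hc
  have : Nonempty ι := ⟨i₁⟩
  obtain ⟨i₀, hi₀⟩ := Finite.exists_max fun i => v.valuation (c i)
  have hk : c i₀ ≠ 0 := fun h0 => hi₁ (by
    have := hi₀ i₁
    rw [h0, map_zero, le_zero_iff, map_eq_zero] at this
    exact this)
  refine ⟨c i₀, hk, ?_⟩
  have hd : ∀ i, c i / c i₀ ∈ v := fun i => by
    rw [← ValuationSubring.valuation_le_one_iff, map_div₀]
    exact div_le_one_of_le₀ (hi₀ i) zero_le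
  let d : ι → v := fun i => ⟨c i / c i₀, hd i⟩
  let y : V := ∑ i, ⟨algebraMap K L (d i), (h.mem_iff _).2 (d i).2⟩ * s i
  have hy : residue V y = ∑ i, residue v (d i) • residue V (s i) := by
    simp only [y, map_sum, map_mul]
    rfl
  have hy0 : residue V y ≠ 0 := by
    intro h0
    have := Fintype.linearIndependent_iff.1 hs (fun i => residue v (d i)) (hy ▸ h0) i₀
    have h1 : d i₀ = 1 := Subtype.ext (div_self hk)
    rw [h1, map_one] at this
    exact one_ne_zero this
  have hy1 : V.valuation (y : L) = 1 :=
    (V.valuation_eq_one_iff y).1 ((residue_ne_zero_iff_isUnit y).1 hy0)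
  have e : ∑ i, algebraMap K L (c i) * (s i : L) = algebraMap K L (c i₀) * (y : L) := by
    have hyL : (y : L) = ∑ i, algebraMap K L (c i / c i₀) * (s i : L) := by
      change V.subtype y = _
      simp only [y, map_sum, map_mul]
      rfl
    rw [hyL, Finset.mul_sum]
    refine Finset.sum_congr rfl fun i _ => ?_
    rw [← mul_assoc, ← map_mul, mul_div_cancel₀ _ hk]
  rw [e, map_mul, hy1, mul_one]

/-- The products of elements with linearly independent residues and elements in distinct classes
modulo the value group of `K` are linearly independent over `K`. -/
theorem card_mul_card_le_finrank [FiniteDimensional K L] {ι κ : Type*} [Fintype ι] [Fintype κ]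
    (h : IsExtension v V) (s : ι → V)
    (hs : letI := (residueMap h).toAlgebra
      LinearIndependent (ResidueField v) fun i => residue V (s i))
    (t : κ → Lˣ) (ht : ∀ j j', (t j)⁻¹ * t j' ∈ valueSubgroup K V → j = j') :
    Fintype.card ι * Fintype.card κ ≤ Module.finrank K L := by
  classical
  rw [mul_comm, ← Fintype.card_prod]
  suffices LinearIndependent K fun ji : κ × ι => (s ji.2 : L) * (t ji.1 : L) from
    this.fintype_card_le_finrank
  rw [Fintype.linearIndependent_iff]
  intro c hc
  let y : κ → L := fun j => ∑ i, algebraMap K L (c (j, i)) * (s i : L)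
  have hsum : ∑ j, y j * (t j : L) = 0 := by
    rw [← hc, Fintype.sum_prod_type]
    refine Finset.sum_congr rfl fun j _ => ?_
    rw [Finset.sum_mul]
    refine Finset.sum_congr rfl fun i _ => ?_
    rw [Algebra.smul_def, mul_assoc]
  by_contra hne
  push Not at hne
  obtain ⟨⟨j₁, i₁⟩, hji⟩ := hne
  have hval : ∀ j, (∃ i, c (j, i) ≠ 0) → ∃ k : K, k ≠ 0 ∧
      V.valuation (y j) = V.valuation (algebraMap K L k) := fun j ⟨i, hi⟩ =>
    exists_valuation_sum_eq h s hs (fun i => c (j, i)) fun h0 => hi (congrFun h0 i)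
  have hy0 : ∀ j, y j ≠ 0 → ∃ k : K, k ≠ 0 ∧
      V.valuation (y j) = V.valuation (algebraMap K L k) := fun j hj => hval j (by
    by_contra hcon
    push Not at hcon
    exact hj (Finset.sum_eq_zero fun i _ => by rw [hcon i, map_zero, zero_mul]))
  have : Nonempty κ := ⟨j₁⟩
  obtain ⟨j₀, hj₀⟩ := Finite.exists_max fun j => V.valuation (y j * (t j : L))
  have hj₁ : V.valuation (y j₁ * (t j₁ : L)) ≠ 0 := by
    obtain ⟨k, hk, hk'⟩ := hval j₁ ⟨i₁, hji⟩
    rw [map_mul, hk']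
    simp [hk]
  have hj₀0 : V.valuation (y j₀ * (t j₀ : L)) ≠ 0 := fun h0 => hj₁ (by
    have := hj₀ j₁
    rw [h0] at this
    exact le_zero_iff.1 this)
  have hv0 := V.valuation.map_sum_eq_of_lt (s := Finset.univ)
    (f := fun j => y j * (t j : L)) (Finset.mem_univ j₀) (fun j hj => by
      refine lt_of_le_of_ne (hj₀ j) fun heq => ?_
      have hjne : j ≠ j₀ := by simpa using hj
      have hyj : y j ≠ 0 := fun h0 => hj₀0 (by rw [← heq, h0, zero_mul, map_zero])
      have hyj₀ : y j₀ ≠ 0 := fun h0 => hj₀0 (by rw [h0, zero_mul, map_zero])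
      obtain ⟨k, hk, hk'⟩ := hy0 j hyj
      obtain ⟨l, hl, hl'⟩ := hy0 j₀ hyj₀
      refine hjne (ht _ _ ((mem_valueSubgroup_iff _).2 ⟨k / l, ?_⟩))
      simp only [map_mul, hk', hl'] at heq
      have hl0 : V.valuation (algebraMap K L l) ≠ 0 := by simp [hl]
      have ht0 : V.valuation (t j : L) ≠ 0 := by simp
      rw [Units.val_mul, map_mul, Units.val_inv_eq_inv_val, map_inv₀, map_div₀, map_div₀,
        inv_mul_eq_div, div_eq_div_iff ht0 hl0, mul_comm, ← heq])
  rw [hsum, map_zero] at hv0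
  exact hj₀0 hv0.symm

theorem residueDegree_pos [FiniteDimensional K L] (h : IsExtension v V) : 0 < residueDegree h := by
  let := (residueMap h).toAlgebra
  suffices Module.Finite (ResidueField v) (ResidueField V) from Module.finrank_pos
  rw [← Module.rank_lt_aleph0_iff]
  by_contra hcon
  have hle : ((Module.finrank K L + 1 : ℕ) : Cardinal) ≤
      Module.rank (ResidueField v) (ResidueField V) :=
    Cardinal.natCast_lt_aleph0.le.trans (not_lt.1 hcon)
  obtain ⟨f, hf⟩ := exists_linearIndependent_of_le_rank hle
  choose s hs using fun i => residue_surjective (f i)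
  have := card_mul_card_le_finrank h s (by simpa only [hs] using hf) (fun _ : Unit => 1)
    (fun _ _ _ => rfl)
  simp at this

theorem ramificationIndex_pos [FiniteDimensional K L] (h : IsExtension v V) :
    0 < ramificationIndex K V := by
  let := (residueMap h).toAlgebra
  rw [ramificationIndex_eq_index, Nat.pos_iff_ne_zero, ← Subgroup.finiteIndex_iff,
    Subgroup.finiteIndex_iff_finite_quotient]
  by_contra hcon
  rw [not_finite_iff_infinite] at hcon
  let g := Infinite.natEmbedding (Lˣ ⧸ valueSubgroup K V)
  have hli : LinearIndependent (ResidueField v) fun _ : Unit => residue V 1 :=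
    LinearIndependent.of_subsingleton () (by simp)
  have := card_mul_card_le_finrank h (fun _ : Unit => 1) hli
    (fun j : Fin (Module.finrank K L + 1) => (g j).out) (fun j j' hjj => by
      rw [← QuotientGroup.eq, QuotientGroup.out_eq', QuotientGroup.out_eq'] at hjj
      exact Fin.ext (g.injective hjj))
  simp at this

/-- The fundamental inequality `(vL : vK) [Lv : Kv] ≤ [L : K]`. -/
theorem ramificationIndex_mul_residueDegree_le [FiniteDimensional K L] (h : IsExtension v V) :
    ramificationIndex K V * residueDegree h ≤ Module.finrank K L := by
  let := (residueMap h).toAlgebra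
  have hf := residueDegree_pos h
  have he := ramificationIndex_pos h
  have : Module.Finite (ResidueField v) (ResidueField V) := Module.finite_of_finrank_pos hf
  rw [ramificationIndex_eq_index, Nat.pos_iff_ne_zero, ← Subgroup.finiteIndex_iff,
    Subgroup.finiteIndex_iff_finite_quotient] at he
  have := Fintype.ofFinite (Lˣ ⧸ valueSubgroup K V)
  let b := Module.finBasis (ResidueField v) (ResidueField V)
  choose s hs using fun i => residue_surjective (b i)
  have := card_mul_card_le_finrank h s (by simpa only [hs] using b.linearIndependent)
    (fun j : Lˣ ⧸ valueSubgroup K V => j.out) (fun j j' hjj => by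
      rwa [← QuotientGroup.eq, QuotientGroup.out_eq', QuotientGroup.out_eq'] at hjj)
  rw [Fintype.card_fin, mul_comm, ← Nat.card_eq_fintype_card] at this
  rw [ramificationIndex_eq_index]
  exact this

theorem isDefectlessExtension_of_le_residueDegree [FiniteDimensional K L] (h : IsExtension v V)
    (hf : Module.finrank K L ≤ residueDegree h) : IsDefectlessExtension h :=
  le_antisymm (hf.trans (Nat.le_mul_of_pos_left _ (ramificationIndex_pos h)))
    (ramificationIndex_mul_residueDegree_le h)

/-- An automorphism of finite order preserving a valuation ring preserves the valuation. -/
theorem valuation_algEquiv_apply [FiniteDimensional K L] (V : ValuationSubring L)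
    (hV : ∀ (σ : L ≃ₐ[K] L) (x : L), σ x ∈ V ↔ x ∈ V) (σ : L ≃ₐ[K] L) (x : L) :
    V.valuation (σ x) = V.valuation x := by
  have hequiv : ∀ σ : L ≃ₐ[K] L, (V.valuation.comap (σ : L →+* L)).IsEquiv V.valuation := fun σ =>
    Valuation.isEquiv_of_val_le_one fun {x} => by
      rw [Valuation.comap_apply, ValuationSubring.valuation_le_one_iff,
        ValuationSubring.valuation_le_one_iff]
      exact hV σ x
  have key : ∀ (σ : L ≃ₐ[K] L) (x : L), V.valuation x ≤ V.valuation (σ x) := by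
    intro σ x
    by_contra! hlt
    have hn : ∀ n : ℕ, V.valuation ((σ ^ (n + 1)) x) < V.valuation x := by
      intro n
      induction n with
      | zero => simpa using hlt
      | succ n ih =>
        rw [pow_succ']
        exact (((hequiv σ).lt_iff_lt (x := (σ ^ (n + 1)) x) (y := x)).2 ih).trans hlt
    have h1 := hn (orderOf σ - 1)
    rw [Nat.sub_add_cancel (orderOf_pos σ), pow_orderOf_eq_one] at h1
    exact lt_irrefl _ h1
  refine le_antisymm ?_ (key σ x)
  have := key σ.symm (σ x)
  rwa [σ.symm_apply_apply] at this

/-- A Galois defect extension of prime degree does not extend the value group: the quotient of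
the value groups is killed by the degree because of the norm. -/
theorem exists_valuation_eq_of_defect [FiniteDimensional K L] [IsGalois K L] {p : ℕ}
    (hp : p.Prime) (hdeg : Module.finrank K L = p) (h : IsExtension v V)
    (hV : ∀ (σ : L ≃ₐ[K] L) (x : L), σ x ∈ V ↔ x ∈ V) (hdef : ¬ IsDefectlessExtension h) (x : L) :
    ∃ k : K, V.valuation x = V.valuation (algebraMap K L k) := by
  by_contra hx
  have hx0 : x ≠ 0 := by
    rintro rfl
    exact hx ⟨0, by simp⟩
  let q : Lˣ ⧸ valueSubgroup K V := (Units.mk0 x hx0 : Lˣ)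
  have hq1 : q ≠ 1 := fun h1 => hx ((mem_valueSubgroup_iff _).1 ((QuotientGroup.eq_one_iff _).1 h1))
  have hqp : q ^ p = 1 := by
    rw [← QuotientGroup.mk_pow, QuotientGroup.eq_one_iff, mem_valueSubgroup_iff]
    refine ⟨Algebra.norm K x, ?_⟩
    rw [Algebra.norm_eq_prod_automorphisms, map_prod,
      Finset.prod_congr rfl fun σ _ => valuation_algEquiv_apply V hV σ x, Finset.prod_const,
      Finset.card_univ, ← Nat.card_eq_fintype_card, IsGalois.card_aut_eq_finrank, hdeg]
    simp
  have : Fact p.Prime := ⟨hp⟩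
  have hdvd := orderOf_dvd_natCard q
  rw [orderOf_eq_prime hqp hq1] at hdvd
  have he : p ≤ ramificationIndex K V := by
    rw [ramificationIndex_eq_index]
    have hpos := ramificationIndex_pos h
    rw [ramificationIndex_eq_index] at hpos
    exact Nat.le_of_dvd hpos hdvd
  refine hdef (le_antisymm ?_ (ramificationIndex_mul_residueDegree_le h))
  rw [hdeg]
  exact he.trans (Nat.le_mul_of_pos_right _ (residueDegree_pos h))

theorem exists_pow_eq_of_finrank_prime [FiniteDimensional K L] [IsGalois K L] {p : ℕ}
    (hp : p.Prime) (hdeg : Module.finrank K L = p) {σ : L ≃ₐ[K] L} (hσ : σ ≠ 1) (τ : L ≃ₐ[K] L) :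
    ∃ n : ℕ, σ ^ n = τ := by
  have : Fact p.Prime := ⟨hp⟩
  have hcard : Nat.card (L ≃ₐ[K] L) = p := by rw [IsGalois.card_aut_eq_finrank, hdeg]
  exact ((isOfFinOrder_of_finite σ).mem_powers_iff_mem_zpowers).2
    (mem_zpowers_of_prime_card hcard hσ)

end Inequality

/-! ### Independent defect in terms of coarsenings -/

section Criterion

variable {K L : Type u} [Field K] [Field L] [Algebra K L] {v : ValuationSubring K}
  {V : ValuationSubring L}

theorem exists_unit_valuation_eq (v : ValuationSubring K) (γ : v.ValueGroupˣ) :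
    ∃ x : K, x ≠ 0 ∧ (γ : v.ValueGroup) = v.valuation x := by
  obtain ⟨x, hx⟩ := units_map_valuation_surjective v γ
  exact ⟨x, x.ne_zero, (congrArg Units.val hx).symm⟩

/-- The coarsening of `v` with the convex subgroup `H` consists of the elements whose value is
bounded below by an element of `H`. -/
def coarsening (v : ValuationSubring K) (H : Subgroup v.ValueGroupˣ) : ValuationSubring K where
  carrier := {x | ∃ h ∈ H, v.valuation x ≤ (h : v.ValueGroup)}
  zero_mem' := ⟨1, H.one_mem, by simp⟩
  one_mem' := ⟨1, H.one_mem, by simp⟩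
  add_mem' := by
    rintro x y ⟨h, hh, hx⟩ ⟨k, hk, hy⟩
    rcases le_total h k with hle | hle
    · exact ⟨k, hk, v.valuation.map_add_le (hx.trans hle) hy⟩
    · exact ⟨h, hh, v.valuation.map_add_le hx (hy.trans hle)⟩
  mul_mem' := by
    rintro x y ⟨h, hh, hx⟩ ⟨k, hk, hy⟩
    exact ⟨h * k, H.mul_mem hh hk, by rw [map_mul, Units.val_mul]; exact mul_le_mul' hx hy⟩
  neg_mem' := by
    rintro x ⟨h, hh, hx⟩
    exact ⟨h, hh, by rwa [Valuation.map_neg]⟩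
  mem_or_inv_mem' := by
    intro x
    rcases v.mem_or_inv_mem x with h | h
    · exact Or.inl ⟨1, H.one_mem, (v.valuation_le_one_iff x).2 h⟩
    · exact Or.inr ⟨1, H.one_mem, (v.valuation_le_one_iff _).2 h⟩

theorem mem_coarsening_iff (H : Subgroup v.ValueGroupˣ) (x : K) :
    x ∈ coarsening v H ↔ ∃ h ∈ H, v.valuation x ≤ (h : v.ValueGroup) :=
  Iff.rfl

theorem coarsening_valuation_lt_one_iff (H : Subgroup v.ValueGroupˣ) (x : K) :
    (coarsening v H).valuation x < 1 ↔ ∀ h ∈ H, v.valuation x < (h : v.ValueGroup) := by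
  rw [valuation_lt_one_iff_or]
  by_cases hx : x = 0
  · simp only [hx, true_or, map_zero, true_iff]
    exact fun h _ => zero_lt_iff.2 h.ne_zero
  simp only [hx, false_or, mem_coarsening_iff, not_exists, not_and, not_le]
  have hx0 : 0 < v.valuation x := v.valuation.pos_iff.2 hx
  constructor
  · intro h k hk
    have := h k⁻¹ (H.inv_mem hk)
    rwa [map_inv₀, Units.val_inv_eq_inv_val,
      inv_lt_inv₀ (zero_lt_iff.2 k.ne_zero) hx0] at this
  · intro h k hk
    have := h k⁻¹ (H.inv_mem hk)
    rw [map_inv₀]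
    rw [Units.val_inv_eq_inv_val] at this
    exact (lt_inv_comm₀ hx0 (zero_lt_iff.2 k.ne_zero)).1 this

/-- For a coarsening `O` of `v`, an element lies in the maximal ideal of `O` if and only if its
`v`-value is greater than the convex subgroup of `O`. -/
theorem forall_mem_ker_lt_iff {O : ValuationSubring K} (hO : v ≤ O) (x : K) :
    (∀ h ∈ (Units.map (v.mapOfLE O hO : v.ValueGroup →* O.ValueGroup)).ker,
      v.valuation x < (h : v.ValueGroup)) ↔ O.valuation x < 1 := by
  constructor
  · intro h
    refine lt_of_le_of_ne ?_ fun h1 => ?_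
    · have := h 1 (one_mem _)
      rw [O.valuation_le_one_iff]
      exact hO ((v.valuation_le_one_iff x).1 this.le)
    · have hx0 : x ≠ 0 := by
        rintro rfl
        rw [map_zero] at h1
        exact zero_ne_one h1
      have hmem : Units.map (v.valuation : K →* v.ValueGroup) (Units.mk0 x hx0) ∈
          (Units.map (v.mapOfLE O hO : v.ValueGroup →* O.ValueGroup)).ker :=
        Units.ext ((v.mapOfLE_valuation_apply O hO x).trans h1)
      exact lt_irrefl _ (h _ hmem)
  · intro hx h hh
    by_contra! hle
    have h1 : v.mapOfLE O hO h = 1 := congrArg Units.val (MonoidHom.mem_ker.1 hh)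
    have := v.monotone_mapOfLE O hO hle
    rw [h1, v.mapOfLE_valuation_apply] at this
    exact this.not_gt hx

/-- Convex subgroups correspond to coarsenings `O`.  In terms of `O`, the subgroup is proper when
`O` is not the trivial valuation ring, the quotient has no minimum positive element when the maximal
ideal of `O` is not principal, and the `α > H` are the values of the elements of the maximal ideal
of `O`. -/
theorem hasIndependentDefect_iff :
    HasIndependentDefect v V ↔ ∃ O : ValuationSubring K, v ≤ O ∧ O ≠ ⊤ ∧
      (∀ x, x ≠ 0 → O.valuation x < 1 → ∃ y, O.valuation y < 1 ∧ y / x ∉ O) ∧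
      ∀ σ : L ≃ₐ[K] L, σ ≠ 1 → sigmaSet V σ =
        {α | ∃ x : K, O.valuation x < 1 ∧ α = V.valuation (algebraMap K L x)} := by
  constructor
  · rintro ⟨H, hconv, hne, hmin, hsig⟩
    refine ⟨coarsening v H, fun x hx => ⟨1, H.one_mem, (v.valuation_le_one_iff x).2 hx⟩, ?_, ?_, ?_⟩
    · intro htop
      refine hne ((Subgroup.eq_top_iff' H).2 fun γ => ?_)
      obtain ⟨x, hx0, hx⟩ := exists_unit_valuation_eq v γ
      obtain ⟨h, hh, hxh⟩ : x ∈ coarsening v H := htop ▸ ValuationSubring.mem_top x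
      obtain ⟨k, hk, hxk⟩ : x⁻¹ ∈ coarsening v H := htop ▸ ValuationSubring.mem_top _
      rw [← hx] at hxh
      rw [map_inv₀, ← hx, ← Units.val_inv_eq_inv_val, Units.val_le_val] at hxk
      exact hconv.out (H.inv_mem hk) hh ⟨inv_le_of_inv_le' hxk, hxh⟩
    · intro x hx0 hx
      rw [coarsening_valuation_lt_one_iff] at hx
      by_contra! hcon
      refine hmin ⟨Units.map (v.valuation : K →* v.ValueGroup) (Units.mk0 x hx0), hx, ?_⟩
      intro δ hδ
      obtain ⟨y, hy0, hy⟩ := exists_unit_valuation_eq v δ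
      obtain ⟨h, hh, hle⟩ := hcon y ((coarsening_valuation_lt_one_iff H y).2 fun k hk => by
        rw [← hy]; exact hδ k hk)
      refine ⟨h, hh, ?_⟩
      rw [map_div₀, div_le_iff₀ (v.valuation.pos_iff.2 hx0), mul_comm, ← hy] at hle
      exact hle
    · intro σ hσ
      rw [hsig σ hσ]
      ext α
      simp only [Set.mem_ofPred_eq, coarsening_valuation_lt_one_iff]
  · rintro ⟨O, hO, hne, hmin, hsig⟩
    refine ⟨(Units.map (v.mapOfLE O hO : v.ValueGroup →* O.ValueGroup)).ker, ⟨?_⟩, ?_, ?_, ?_⟩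
    · intro a ha b hb c hc
      have h1 : v.mapOfLE O hO a = 1 := congrArg Units.val (MonoidHom.mem_ker.1 ha)
      have h2 : v.mapOfLE O hO b = 1 := congrArg Units.val (MonoidHom.mem_ker.1 hb)
      refine Units.ext (le_antisymm ?_ ?_)
      · exact (v.monotone_mapOfLE O hO (Units.val_le_val.2 hc.2)).trans h2.le
      · exact h1.ge.trans (v.monotone_mapOfLE O hO (Units.val_le_val.2 hc.1))
    · intro htop
      refine hne (ValuationSubring.ext _ _ fun x => ⟨fun _ => ValuationSubring.mem_top x,
        fun _ => ?_⟩)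
      by_cases hx0 : x = 0
      · exact hx0 ▸ O.zero_mem
      have hmem : Units.map (v.valuation : K →* v.ValueGroup) (Units.mk0 x hx0) ∈
          (Units.map (v.mapOfLE O hO : v.ValueGroup →* O.ValueGroup)).ker :=
        htop ▸ Subgroup.mem_top _
      have h1 : v.mapOfLE O hO (v.valuation x) = 1 :=
        congrArg Units.val (MonoidHom.mem_ker.1 hmem)
      rw [v.mapOfLE_valuation_apply] at h1
      exact (O.valuation_le_one_iff x).1 h1.le
    · rintro ⟨γ, hγ, hγmin⟩
      obtain ⟨x, hx0, hx⟩ := exists_unit_valuation_eq v γ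
      obtain ⟨y, hy, hyx⟩ := hmin x hx0 ((forall_mem_ker_lt_iff hO x).1 fun h hh => by
        rw [← hx]; exact hγ h hh)
      have hy0 : y ≠ 0 := by
        rintro rfl
        rw [zero_div] at hyx
        exact hyx O.zero_mem
      obtain ⟨h, hh, hle⟩ := hγmin (Units.map (v.valuation : K →* v.ValueGroup) (Units.mk0 y hy0))
        fun h hh => (forall_mem_ker_lt_iff hO y).2 hy h hh
      have h1 : v.mapOfLE O hO h = 1 := congrArg Units.val (MonoidHom.mem_ker.1 hh)
      have h2 := v.monotone_mapOfLE O hO (Units.val_le_val.2 hle)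
      rw [Units.val_mul, map_mul, h1, mul_one, hx, v.mapOfLE_valuation_apply] at h2
      have h3 : O.valuation y ≤ O.valuation x := by
        rw [← v.mapOfLE_valuation_apply O hO y]
        exact h2
      refine hyx ((O.valuation_le_one_iff _).1 ?_)
      rw [map_div₀]
      exact div_le_one_of_le₀ h3 zero_le
    · intro σ hσ
      rw [hsig σ hσ]
      ext α
      simp only [Set.mem_ofPred_eq, forall_mem_ker_lt_iff]

end Criterion

/-! ### Composite valuations in extensions -/

section Compose

variable {K : Type u} [Field K] {w : ValuationSubring K} {vbar : ValuationSubring (ResidueField w)}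

theorem coe_mem_compose_iff (x : w) : (x : K) ∈ compose w vbar ↔ residue w x ∈ vbar := by
  rw [mem_compose_iff]
  exact ⟨fun ⟨_, h⟩ => h, fun h => ⟨x.2, h⟩⟩

theorem compose_le : compose w vbar ≤ w := fun x hx => ((mem_compose_iff w vbar x).1 hx).1

/-- The valuation induced on the residue field of a coarsening. -/
noncomputable def residueValuation {v w : ValuationSubring K} (hvw : v ≤ w) :
    ValuationSubring (ResidueField w) :=
  ValuationSubring.ofSubring ((v.toSubring.comap w.subtype).map (residue w)) (by
    intro y
    obtain ⟨x, rfl⟩ := residue_surjective y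
    rcases v.mem_or_inv_mem (x : K) with h | h
    · exact Or.inl ⟨x, h, rfl⟩
    · refine Or.inr ⟨⟨(x : K)⁻¹, hvw h⟩, h, ?_⟩
      by_cases hx : x = 0
      · simp only [hx, ZeroMemClass.coe_zero, inv_zero, map_zero]
        exact map_zero _
      · refine eq_inv_of_mul_eq_one_left ?_
        rw [← map_mul, ← map_one (residue w)]
        exact congrArg _ (Subtype.ext (inv_mul_cancel₀ fun h0 => hx (Subtype.ext h0))))

theorem compose_residueValuation {v w : ValuationSubring K} (hvw : v ≤ w) :
    compose w (residueValuation hvw) = v := by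
  refine ValuationSubring.ext _ _ fun x => ?_
  rw [mem_compose_iff]
  constructor
  · rintro ⟨hx, y, hy, hyx⟩
    have h1 : (y : K) - x ∈ w.nonunits := by
      have : y - ⟨x, hx⟩ ∈ maximalIdeal w := by
        rw [← residue_eq_zero_iff, map_sub, hyx, sub_self]
      exact (ValuationSubring.coe_mem_nonunits_iff (a := y - ⟨x, hx⟩)).2 this
    have h2 : (y : K) - x ∈ v :=
      ValuationSubring.nonunits_subset (ValuationSubring.nonunits_le_nonunits.2 hvw h1)
    have := v.toSubring.sub_mem hy h2
    rwa [ValuationSubring.subtype_apply, sub_sub_cancel] at this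
  · intro hx
    exact ⟨hvw hx, ⟨x, hvw hx⟩, hx, rfl⟩

theorem residue_ne_zero_iff_valuation (x : w) : residue w x ≠ 0 ↔ w.valuation (x : K) = 1 := by
  rw [residue_ne_zero_iff_isUnit, ValuationSubring.valuation_eq_one_iff]

theorem residue_eq_zero_iff_valuation (x : w) : residue w x = 0 ↔ w.valuation (x : K) < 1 := by
  rw [residue_eq_zero_iff, ValuationSubring.valuation_lt_one_iff]

/-- Elements of `𝒪_w` are compared by the composite valuation through their residues. -/
theorem compose_valuation_le_iff (x y : w) (hy : residue w y ≠ 0) :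
    (compose w vbar).valuation (x : K) ≤ (compose w vbar).valuation (y : K) ↔
      vbar.valuation (residue w x) ≤ vbar.valuation (residue w y) := by
  have hy1 := (residue_ne_zero_iff_valuation y).1 hy
  have hy0 : (y : K) ≠ 0 := fun h0 => by
    rw [h0, map_zero] at hy1
    exact zero_ne_one hy1
  have hz : (x : K) / y ∈ w := by
    rw [← ValuationSubring.valuation_le_one_iff, map_div₀, hy1, div_one]
    exact w.valuation_le_one x
  have hres : residue w ⟨(x : K) / y, hz⟩ = residue w x / residue w y := by
    rw [eq_div_iff hy, ← map_mul]
    exact congrArg _ (Subtype.ext (div_mul_cancel₀ _ hy0))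
  have h1 := coe_mem_compose_iff (vbar := vbar) ⟨(x : K) / y, hz⟩
  rw [hres, ← ValuationSubring.valuation_le_one_iff, ← ValuationSubring.valuation_le_one_iff,
    map_div₀, map_div₀, div_le_one₀ (Valuation.pos_iff _ |>.2 hy0),
    div_le_one₀ (Valuation.pos_iff _ |>.2 hy)] at h1
  exact h1

theorem compose_valuation_eq_iff (x y : w) (hx : residue w x ≠ 0) (hy : residue w y ≠ 0) :
    (compose w vbar).valuation (x : K) = (compose w vbar).valuation (y : K) ↔
      vbar.valuation (residue w x) = vbar.valuation (residue w y) := by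
  rw [le_antisymm_iff, compose_valuation_le_iff x y hy, compose_valuation_le_iff y x hx,
    ← le_antisymm_iff]

/-- A finer valuation determines a coarser one on quotients. -/
theorem valuation_eq_of_le {v w : ValuationSubring K} (hvw : v ≤ w) {x y : K}
    (h : v.valuation x = v.valuation y) : w.valuation x = w.valuation y := by
  rw [← v.mapOfLE_valuation_apply w hvw, h, v.mapOfLE_valuation_apply]

theorem valuation_lt_of_le {v w : ValuationSubring K} (hvw : v ≤ w) {x y : K}
    (h : w.valuation x < w.valuation y) : v.valuation x < v.valuation y := by
  by_contra! hle
  have := v.monotone_mapOfLE w hvw hle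
  rw [v.mapOfLE_valuation_apply, v.mapOfLE_valuation_apply] at this
  exact this.not_gt h

end Compose

section ExtendCoarsening

variable {K L : Type u} [Field K] [Field L] [Algebra K L]

/-- The coarsening `𝒪_w 𝒪_V` of `V`: the elements of `L` whose value is bounded below by the value
of an element of `𝒪_w`. -/
def extendCoarsening (w : ValuationSubring K) (V : ValuationSubring L) : ValuationSubring L where
  carrier := {x | ∃ s ∈ w, V.valuation x ≤ V.valuation (algebraMap K L s)}
  zero_mem' := ⟨1, w.one_mem, by simp⟩
  one_mem' := ⟨1, w.one_mem, by simp⟩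
  add_mem' := by
    rintro x y ⟨s, hs, hx⟩ ⟨t, ht, hy⟩
    rcases le_total (V.valuation (algebraMap K L s)) (V.valuation (algebraMap K L t)) with h | h
    · exact ⟨t, ht, V.valuation.map_add_le (hx.trans h) hy⟩
    · exact ⟨s, hs, V.valuation.map_add_le hx (hy.trans h)⟩
  mul_mem' := by
    rintro x y ⟨s, hs, hx⟩ ⟨t, ht, hy⟩
    exact ⟨s * t, w.mul_mem _ _ hs ht, by rw [map_mul, map_mul, map_mul]; exact mul_le_mul' hx hy⟩
  neg_mem' := by
    rintro x ⟨s, hs, hx⟩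
    exact ⟨s, hs, by rwa [Valuation.map_neg]⟩
  mem_or_inv_mem' := by
    intro x
    rcases V.mem_or_inv_mem x with h | h
    · exact Or.inl ⟨1, w.one_mem, by simpa using (V.valuation_le_one_iff x).2 h⟩
    · exact Or.inr ⟨1, w.one_mem, by simpa using (V.valuation_le_one_iff _).2 h⟩

theorem mem_extendCoarsening_iff (w : ValuationSubring K) (V : ValuationSubring L) (x : L) :
    x ∈ extendCoarsening w V ↔ ∃ s ∈ w, V.valuation x ≤ V.valuation (algebraMap K L s) :=
  Iff.rfl

theorem le_extendCoarsening (w : ValuationSubring K) (V : ValuationSubring L) :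
    V ≤ extendCoarsening w V := fun x hx =>
  ⟨1, w.one_mem, by simpa using (V.valuation_le_one_iff x).2 hx⟩

theorem isExtension_extendCoarsening {v w : ValuationSubring K} {V : ValuationSubring L}
    (h : IsExtension v V) (hvw : v ≤ w) : IsExtension w (extendCoarsening w V) := by
  refine ValuationSubring.ext _ _ fun x => ⟨?_, fun hx => ⟨x, hx, le_rfl⟩⟩
  rintro ⟨s, hs, hle⟩
  rw [h.valuation_le_iff, v.valuation_le_iff] at hle
  obtain ⟨a, rfl⟩ := hle
  exact w.mul_mem _ _ (hvw a.2) hs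

theorem mem_extendCoarsening_algEquiv_iff [FiniteDimensional K L] (w : ValuationSubring K)
    {V : ValuationSubring L} (hV : ∀ (σ : L ≃ₐ[K] L) (x : L), σ x ∈ V ↔ x ∈ V) (σ : L ≃ₐ[K] L)
    (x : L) : σ x ∈ extendCoarsening w V ↔ x ∈ extendCoarsening w V := by
  rw [mem_extendCoarsening_iff, mem_extendCoarsening_iff, valuation_algEquiv_apply V hV]

end ExtendCoarsening

/-! ### The Galois group of the residue field extension -/

section Residue

variable {K L : Type u} [Field K] [Field L] [Algebra K L] {w : ValuationSubring K}
  {W : ValuationSubring L}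

theorem residueDegree_eq_finrank (h : IsExtension w W)
    [Algebra (ResidueField w) (ResidueField W)]
    (halg : algebraMap (ResidueField w) (ResidueField W) = residueMap h) :
    residueDegree h = Module.finrank (ResidueField w) (ResidueField W) := by
  have : ‹Algebra (ResidueField w) (ResidueField W)› = (residueMap h).toAlgebra :=
    Algebra.algebra_ext _ _ fun r => by rw [halg]; rfl
  subst this
  rfl

/-- The automorphism of the valuation ring induced by an automorphism of the field. -/
def integerEquiv (hW : ∀ (σ : L ≃ₐ[K] L) (x : L), σ x ∈ W ↔ x ∈ W) (σ : L ≃ₐ[K] L) : W ≃+* W where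
  toFun x := ⟨σ x, (hW σ x).2 x.2⟩
  invFun x := ⟨σ.symm x, (hW σ.symm x).2 x.2⟩
  left_inv x := Subtype.ext (σ.symm_apply_apply x)
  right_inv x := Subtype.ext (σ.apply_symm_apply x)
  map_mul' x y := Subtype.ext (map_mul σ (x : L) y)
  map_add' x y := Subtype.ext (map_add σ (x : L) y)

/-- The automorphism of the residue field extension induced by an automorphism of the field. -/
noncomputable def residueEquiv (h : IsExtension w W) [Algebra (ResidueField w) (ResidueField W)]
    (halg : algebraMap (ResidueField w) (ResidueField W) = residueMap h)
    (hW : ∀ (σ : L ≃ₐ[K] L) (x : L), σ x ∈ W ↔ x ∈ W) (σ : L ≃ₐ[K] L) :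
    ResidueField W ≃ₐ[ResidueField w] ResidueField W :=
  AlgEquiv.ofRingEquiv (f := ResidueField.mapEquiv (integerEquiv hW σ)) (by
    intro x
    obtain ⟨x, rfl⟩ := residue_surjective x
    rw [halg, residueMap_residue]
    exact congrArg (residue W) (Subtype.ext (σ.commutes x)))

theorem residueEquiv_residue (h : IsExtension w W) [Algebra (ResidueField w) (ResidueField W)]
    (halg : algebraMap (ResidueField w) (ResidueField W) = residueMap h)
    (hW : ∀ (σ : L ≃ₐ[K] L) (x : L), σ x ∈ W ↔ x ∈ W) (σ : L ≃ₐ[K] L) (x : W) :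
    residueEquiv h halg hW σ (residue W x) = residue W (integerEquiv hW σ x) :=
  rfl

/-- If a Galois extension of prime degree has residue degree `p` over a perfect residue field, then
the Galois group acts faithfully on the residue field: otherwise the residues of traces and norms
of `x` are the elements `p x̄` and `x̄ ^ p`, one of which generates the same field as `x̄`. -/
theorem residueEquiv_ne_one [FiniteDimensional K L] [IsGalois K L] {p : ℕ} (hp : p.Prime)
    (hdeg : Module.finrank K L = p) (h : IsExtension w W)
    [Algebra (ResidueField w) (ResidueField W)]
    (halg : algebraMap (ResidueField w) (ResidueField W) = residueMap h)
    (hW : ∀ (σ : L ≃ₐ[K] L) (x : L), σ x ∈ W ↔ x ∈ W) [PerfectField (ResidueField w)]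
    (hf : Module.finrank (ResidueField w) (ResidueField W) = p) (σ : L ≃ₐ[K] L) (hσ : σ ≠ 1) :
    residueEquiv h halg hW σ ≠ 1 := by
  intro h1
  have : Fact p.Prime := ⟨hp⟩
  have hcard' : Fintype.card (L ≃ₐ[K] L) = p := by
    rw [← Nat.card_eq_fintype_card, IsGalois.card_aut_eq_finrank, hdeg]
  have htriv : ∀ (τ : L ≃ₐ[K] L) (x : W), residue W (integerEquiv hW τ x) = residue W x := by
    intro τ x
    obtain ⟨n, rfl⟩ := exists_pow_eq_of_finrank_prime hp hdeg hσ τ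
    induction n generalizing x with
    | zero => rfl
    | succ n ih =>
      have e : integerEquiv hW (σ ^ (n + 1)) x =
          integerEquiv hW (σ ^ n) (integerEquiv hW σ x) := by
        refine Subtype.ext ?_
        change (σ ^ (n + 1)) (x : L) = (σ ^ n) (σ x)
        rw [pow_succ]
        rfl
      rw [e, ih, ← residueEquiv_residue h halg hW, h1]
      rfl
  have hsurj : Function.Surjective (algebraMap (ResidueField w) (ResidueField W)) := by
    intro y
    obtain ⟨x, rfl⟩ := residue_surjective y
    have hlift : ∀ (k : K) (z : W), algebraMap K L k = z →
        ∃ r, algebraMap (ResidueField w) (ResidueField W) r = residue W z := by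
      intro k z hkz
      refine ⟨residue w ⟨k, (h.mem_iff k).1 (hkz ▸ z.2)⟩, ?_⟩
      rw [halg, residueMap_residue]
      exact congrArg _ (Subtype.ext hkz)
    by_cases hp0 : (p : ResidueField w) = 0
    · have : CharP (ResidueField w) p :=
        ringChar.of_eq (CharP.ringChar_of_prime_eq_zero hp hp0)
      have : CharP (ResidueField W) p := charP_of_injective_algebraMap
        (algebraMap (ResidueField w) (ResidueField W)).injective p
      have := PerfectField.toPerfectRing (K := ResidueField w) p
      obtain ⟨r, hr⟩ := hlift (Algebra.norm K (x : L)) (∏ τ : L ≃ₐ[K] L, integerEquiv hW τ x) (by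
        rw [Algebra.norm_eq_prod_automorphisms]
        exact (map_prod W.subtype (fun τ => integerEquiv hW τ x) Finset.univ).symm)
      rw [map_prod, Finset.prod_congr rfl fun τ _ => htriv τ x, Finset.prod_const,
        Finset.card_univ, hcard'] at hr
      obtain ⟨s, rfl⟩ := (bijective_frobenius (ResidueField w) p).2 r
      refine ⟨s, frobenius_inj (ResidueField W) p ?_⟩
      rw [frobenius_def, frobenius_def, ← hr, frobenius_def, map_pow]
    · obtain ⟨r, hr⟩ := hlift (Algebra.trace K L (x : L)) (∑ τ : L ≃ₐ[K] L, integerEquiv hW τ x) (by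
        rw [trace_eq_sum_automorphisms]
        exact (map_sum W.subtype (fun τ => integerEquiv hW τ x) Finset.univ).symm)
      rw [map_sum, Finset.sum_congr rfl fun τ _ => htriv τ x, Finset.sum_const,
        Finset.card_univ, hcard', nsmul_eq_mul] at hr
      refine ⟨r / p, ?_⟩
      have hp1 : (p : ResidueField W) ≠ 0 := by
        rw [← map_natCast (algebraMap (ResidueField w) (ResidueField W))]
        exact (map_ne_zero _).2 hp0
      rw [map_div₀, hr, map_natCast, mul_div_cancel_left₀ _ hp1]
  have h2 : (⊥ : Subalgebra (ResidueField w) (ResidueField W)) = ⊤ :=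
    Algebra.surjective_algebraMap_iff.1 hsurj |>.symm
  have h3 := Subalgebra.bot_eq_top_iff_finrank_eq_one.1 h2
  exact hp.one_lt.ne' (hf.symm.trans h3)

theorem residueEquiv_injective (h : IsExtension w W) [Algebra (ResidueField w) (ResidueField W)]
    (halg : algebraMap (ResidueField w) (ResidueField W) = residueMap h)
    (hW : ∀ (σ : L ≃ₐ[K] L) (x : L), σ x ∈ W ↔ x ∈ W)
    (hne : ∀ σ : L ≃ₐ[K] L, σ ≠ 1 → residueEquiv h halg hW σ ≠ 1) :
    Function.Injective (residueEquiv h halg hW) := by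
  intro σ τ hστ
  by_contra hcon
  refine hne (σ⁻¹ * τ) (fun h1 => hcon (inv_mul_eq_one.1 h1)) (AlgEquiv.ext fun y => ?_)
  obtain ⟨x, rfl⟩ := residue_surjective y
  have h1 : residueEquiv h halg hW (σ⁻¹ * τ) (residue W x) =
      (residueEquiv h halg hW σ).symm (residueEquiv h halg hW τ (residue W x)) := by
    rw [AlgEquiv.eq_symm_apply, residueEquiv_residue, residueEquiv_residue, residueEquiv_residue]
    exact congrArg _ (Subtype.ext (σ.apply_symm_apply _))
  rw [h1, ← hστ, AlgEquiv.symm_apply_apply, AlgEquiv.one_apply]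

theorem isGalois_residueField [FiniteDimensional K L] [IsGalois K L] (h : IsExtension w W)
    [Algebra (ResidueField w) (ResidueField W)]
    [FiniteDimensional (ResidueField w) (ResidueField W)]
    (halg : algebraMap (ResidueField w) (ResidueField W) = residueMap h)
    (hW : ∀ (σ : L ≃ₐ[K] L) (x : L), σ x ∈ W ↔ x ∈ W)
    (hf : Module.finrank (ResidueField w) (ResidueField W) = Module.finrank K L)
    (hne : ∀ σ : L ≃ₐ[K] L, σ ≠ 1 → residueEquiv h halg hW σ ≠ 1) :
    IsGalois (ResidueField w) (ResidueField W) := by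
  refine IsGalois.of_card_aut_eq_finrank _ _ (le_antisymm ?_ ?_)
  · rw [Nat.card_eq_fintype_card]
    exact AlgEquiv.card_le
  · rw [hf, ← IsGalois.card_aut_eq_finrank]
    exact Nat.card_le_card_of_injective _ (residueEquiv_injective h halg hW hne)

end Residue

/-! ### Lifting independent defect through a composition -/

section Lift

variable {K L : Type u} [Field K] [Field L] [Algebra K L] {w : ValuationSubring K}
  {W : ValuationSubring L} {vbar : ValuationSubring (ResidueField w)}
  {Vbar : ValuationSubring (ResidueField W)}

theorem isExtension_compose_iff (h : IsExtension w W) [Algebra (ResidueField w) (ResidueField W)]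
    (halg : algebraMap (ResidueField w) (ResidueField W) = residueMap h) :
    IsExtension (compose w vbar) (compose W Vbar) ↔ IsExtension vbar Vbar := by
  have key : ∀ x : w, algebraMap K L x ∈ compose W Vbar ↔
      algebraMap (ResidueField w) (ResidueField W) (residue w x) ∈ Vbar := fun x => by
    rw [halg, residueMap_residue]
    exact coe_mem_compose_iff (⟨algebraMap K L x, (h.mem_iff _).2 x.2⟩ : W)
  constructor
  · intro hv
    refine ValuationSubring.ext _ _ fun x => ?_
    obtain ⟨x, rfl⟩ := residue_surjective x
    rw [ValuationSubring.mem_comap, ← key, hv.mem_iff, coe_mem_compose_iff]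
  · intro hv
    refine ValuationSubring.ext _ _ fun x => ?_
    rw [ValuationSubring.mem_comap]
    constructor
    · intro hx
      have hxw : x ∈ w := (h.mem_iff x).1 (compose_le hx)
      exact (coe_mem_compose_iff (⟨x, hxw⟩ : w)).2 ((hv.mem_iff _).1 ((key ⟨x, hxw⟩).1 hx))
    · intro hx
      have hxw : x ∈ w := compose_le hx
      exact (key ⟨x, hxw⟩).2 ((hv.mem_iff _).2 ((coe_mem_compose_iff (⟨x, hxw⟩ : w)).1 hx))

theorem compose_valuation_lt_one_iff (x : w) :
    (compose w vbar).valuation (x : K) < 1 ↔ vbar.valuation (residue w x) < 1 := by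
  by_cases hx : residue w x = 0
  · rw [hx, map_zero]
    refine iff_of_true ?_ zero_lt_one
    have h1 := (residue_eq_zero_iff_valuation x).1 hx
    rw [← map_one (compose w vbar).valuation]
    exact valuation_lt_of_le compose_le (by rwa [map_one])
  · have := compose_valuation_le_iff (vbar := vbar) 1 x hx
    rw [map_one, map_one] at this
    rw [← not_le, ← not_le, ← this]
    simp

/-- Independent defect lifts through a composition of valuations, when the coarser valuation is
unramified with faithful Galois action on its residue field.  The coarsening witnessing it is the
composition of `w` with the coarsening for the residue field extension. -/
theorem HasIndependentDefect.compose (h : IsExtension w W)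
    [Algebra (ResidueField w) (ResidueField W)]
    (halg : algebraMap (ResidueField w) (ResidueField W) = residueMap h)
    (hbar : IsExtension vbar Vbar)
    (hW : ∀ (σ : L ≃ₐ[K] L) (x : L), σ x ∈ W ↔ x ∈ W)
    (hne : ∀ σ : L ≃ₐ[K] L, σ ≠ 1 → residueEquiv h halg hW σ ≠ 1)
    (hram : ∀ x : L, ∃ k : K,
      (compose W Vbar).valuation x = (compose W Vbar).valuation (algebraMap K L k))
    (hind : HasIndependentDefect vbar Vbar) :
    HasIndependentDefect (compose w vbar) (DefectLemma.compose W Vbar) := by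
  rw [hasIndependentDefect_iff] at hind ⊢
  obtain ⟨O, hO, hOne, hmin, hsig⟩ := hind
  have hE : IsExtension (DefectLemma.compose w vbar) (DefectLemma.compose W Vbar) :=
    (isExtension_compose_iff h halg).2 hbar
  have hmax : ∀ x : w, (DefectLemma.compose w O).valuation (x : K) < 1 ↔
      O.valuation (residue w x) < 1 := compose_valuation_lt_one_iff
  have hmem : ∀ x : K, (DefectLemma.compose w O).valuation x < 1 → x ∈ w := fun x hx =>
    compose_le (((DefectLemma.compose w O).valuation_le_one_iff x).1 hx.le)
  -- every element of `L` is the product of an element of `K` and a unit of `𝒪_W`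
  have hunit : ∀ f : L, f ≠ 0 → ∃ (c : K) (u : W), c ≠ 0 ∧ residue W u ≠ 0 ∧
      f = algebraMap K L c * u := by
    intro f hf
    obtain ⟨c, hc⟩ := hram f
    have hc0 : c ≠ 0 := by
      rintro rfl
      rw [map_zero, map_zero, map_eq_zero] at hc
      exact hf hc
    have hcL : algebraMap K L c ≠ 0 := by simpa using hc0
    have h1 : W.valuation (f / algebraMap K L c) = 1 := by
      rw [map_div₀, valuation_eq_of_le compose_le hc]
      exact div_self (by simpa using hc0)
    exact ⟨c, ⟨f / algebraMap K L c, (W.valuation_le_one_iff _).1 h1.le⟩, hc0,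
      (residue_ne_zero_iff_valuation _).2 h1, (mul_div_cancel₀ _ hcL).symm⟩
  have hdiv : ∀ (σ : L ≃ₐ[K] L) (u : W), residue W u ≠ 0 →
      ∃ g : W, (g : L) = (σ u - u) / u ∧ residue W g =
        (residueEquiv h halg hW σ (residue W u) - residue W u) / residue W u := by
    intro σ u hu
    have hu1 := (residue_ne_zero_iff_valuation u).1 hu
    have hu0 : (u : L) ≠ 0 := fun h0 => by
      rw [h0, map_zero] at hu1
      exact zero_ne_one hu1
    have hg : (σ u - u) / (u : L) ∈ W := by
      rw [← W.valuation_le_one_iff, map_div₀, hu1, div_one]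
      exact W.valuation_le_one (integerEquiv hW σ u - u)
    refine ⟨⟨_, hg⟩, rfl, ?_⟩
    rw [eq_div_iff hu, residueEquiv_residue, ← map_mul, ← map_sub]
    exact congrArg _ (Subtype.ext (div_mul_cancel₀ _ hu0))
  refine ⟨DefectLemma.compose w O, fun x hx => ?_, fun htop => hOne ?_, fun x hx0 hx => ?_,
    fun σ hσ => Set.Subset.antisymm ?_ ?_⟩
  · have hxw : x ∈ w := compose_le hx
    exact (coe_mem_compose_iff (⟨x, hxw⟩ : w)).2 (hO ((coe_mem_compose_iff (⟨x, hxw⟩ : w)).1 hx))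
  · refine ValuationSubring.ext _ _ fun y => ⟨fun _ => ValuationSubring.mem_top y, fun _ => ?_⟩
    obtain ⟨x, rfl⟩ := residue_surjective y
    rw [← coe_mem_compose_iff, htop]
    exact ValuationSubring.mem_top _
  · -- if `x` has residue zero, any element of the maximal ideal of `O` outside that of `w` will do
    by_cases hres : residue w ⟨x, hmem x hx⟩ = 0
    · have hexists : ∃ y : ResidueField w, y ≠ 0 ∧ O.valuation y < 1 := by
        by_contra! hcon
        refine hOne (ValuationSubring.ext _ _ fun y => ⟨fun _ => ValuationSubring.mem_top y,
          fun _ => ?_⟩)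
        by_cases hy : y = 0
        · exact hy ▸ O.zero_mem
        have := hcon y⁻¹ (inv_ne_zero hy)
        rw [O.valuation.one_le_val_iff (inv_ne_zero hy), inv_inv] at this
        exact (O.valuation_le_one_iff y).1 this
      obtain ⟨y, hy0, hy⟩ := hexists
      obtain ⟨y, rfl⟩ := residue_surjective y
      refine ⟨y, (hmax y).2 hy, fun hyx => ?_⟩
      have h1 := (residue_ne_zero_iff_valuation y).1 hy0
      have h2 := (residue_eq_zero_iff_valuation _).1 hres
      have h3 := (w.valuation_le_one_iff _).2 (compose_le hyx)
      rw [map_div₀, h1, one_div] at h3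
      exact h3.not_gt ((one_lt_inv₀ (w.valuation.pos_iff.2 hx0)).2 h2)
    · obtain ⟨y, hy, hyx⟩ := hmin _ hres ((hmax ⟨x, hmem x hx⟩).1 hx)
      obtain ⟨y, rfl⟩ := residue_surjective y
      refine ⟨y, (hmax y).2 hy, fun hmemO => hyx ?_⟩
      rw [← ValuationSubring.valuation_le_one_iff, map_div₀] at hmemO ⊢
      rw [div_le_one₀ (Valuation.pos_iff _ |>.2 hres)]
      rw [div_le_one₀ (Valuation.pos_iff _ |>.2 hx0)] at hmemO
      exact (compose_valuation_le_iff y ⟨x, hmem x hx⟩ hres).1 hmemO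
  · rintro α ⟨f, hf, rfl⟩
    obtain ⟨c, u, hc, hu, rfl⟩ := hunit f hf
    obtain ⟨g, hg, hgres⟩ := hdiv σ u hu
    have hcL : algebraMap K L c ≠ 0 := by simpa using hc
    have e : (σ (algebraMap K L c * u) - algebraMap K L c * u) / (algebraMap K L c * u) =
        (g : L) := by
      rw [hg, map_mul, AlgEquiv.commutes, ← mul_sub, mul_div_mul_left _ _ hcL]
    rw [e]
    obtain ⟨k, hk⟩ := hram g
    refine ⟨k, ?_, hk⟩
    have hkW : algebraMap K L k ∈ W := by
      rw [← W.valuation_le_one_iff, ← valuation_eq_of_le compose_le hk]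
      exact W.valuation_le_one g
    have hkw : k ∈ w := (h.mem_iff k).1 hkW
    rw [hmax ⟨k, hkw⟩]
    by_cases hg0 : residue W g = 0
    · have h1 := (residue_eq_zero_iff_valuation g).1 hg0
      rw [valuation_eq_of_le compose_le hk, h.valuation_lt_one_iff] at h1
      rw [(residue_eq_zero_iff_valuation _).2 h1, map_zero]
      exact zero_lt_one
    · have h1 := (residue_ne_zero_iff_valuation g).1 hg0
      rw [valuation_eq_of_le compose_le hk] at h1
      have hk0 : residue W ⟨algebraMap K L k, hkW⟩ ≠ 0 := (residue_ne_zero_iff_valuation _).2 h1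
      have h2 := (compose_valuation_eq_iff g ⟨algebraMap K L k, hkW⟩ hg0 hk0).1 hk
      have h3 : Vbar.valuation (residue W g) ∈ sigmaSet Vbar (residueEquiv h halg hW σ) :=
        ⟨residue W u, hu, by rw [hgres]⟩
      rw [hsig _ (hne σ hσ)] at h3
      obtain ⟨x, hx, hxg⟩ := h3
      have h4 : residue W ⟨algebraMap K L k, hkW⟩ =
          algebraMap (ResidueField w) (ResidueField W) (residue w ⟨k, hkw⟩) := by
        rw [halg, residueMap_residue]
      rw [hxg, h4, hbar.valuation_eq_iff] at h2
      rwa [← valuation_eq_of_le hO h2]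
  · rintro α ⟨x, hx, rfl⟩
    have hxw := hmem x hx
    have hxres : residue W ⟨algebraMap K L x, (h.mem_iff x).2 hxw⟩ =
        algebraMap (ResidueField w) (ResidueField W) (residue w ⟨x, hxw⟩) := by
      rw [halg, residueMap_residue]
    by_cases hx0 : residue w ⟨x, hxw⟩ = 0
    · -- choose `b` moved by `σ` modulo the maximal ideal, and rescale it by an element of `K`
      obtain ⟨b, hb⟩ : ∃ b : W, residueEquiv h halg hW σ (residue W b) ≠ residue W b := by
        by_contra! hcon
        refine hne σ hσ (AlgEquiv.ext fun y => ?_)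
        obtain ⟨y, rfl⟩ := residue_surjective y
        exact hcon y
      obtain ⟨k, hk⟩ := hram (σ b - b)
      have hb1 : W.valuation (σ b - b) = 1 := by
        refine (residue_ne_zero_iff_valuation (integerEquiv hW σ b - b)).1 ?_
        rw [map_sub, ← residueEquiv_residue h halg]
        exact sub_ne_zero.2 hb
      have hk1 : W.valuation (algebraMap K L k) = 1 := by
        rw [← valuation_eq_of_le compose_le hk, hb1]
      have hk0 : algebraMap K L k ≠ 0 := fun h0 => by
        rw [h0, map_zero] at hk1
        exact zero_ne_one hk1
      have hxlt : W.valuation (algebraMap K L x) < 1 :=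
        (h.valuation_lt_one_iff x).2 ((residue_eq_zero_iff_valuation _).1 hx0)
      have hsmall : W.valuation (algebraMap K L (x / k) * b) < 1 := by
        rw [map_mul, map_div₀, map_div₀, hk1, div_one]
        exact mul_lt_one_of_nonneg_of_lt_one_left zero_le hxlt (W.valuation_le_one b)
      have hf1 : (DefectLemma.compose W Vbar).valuation (1 + algebraMap K L (x / k) * b) = 1 := by
        refine Valuation.map_one_add_of_lt _ ?_
        rw [← map_one (DefectLemma.compose W Vbar).valuation]
        exact valuation_lt_of_le compose_le (by rwa [map_one])
      refine ⟨1 + algebraMap K L (x / k) * b, fun h0 => ?_, ?_⟩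
      · rw [h0, map_zero] at hf1
        exact zero_ne_one hf1
      · have e : σ (1 + algebraMap K L (x / k) * b) - (1 + algebraMap K L (x / k) * b) =
            algebraMap K L (x / k) * (σ b - b) := by
          rw [map_add, map_one, map_mul, AlgEquiv.commutes]
          ring
        rw [e, map_div₀, hf1, div_one, map_mul, hk, ← map_mul, map_div₀, div_mul_cancel₀ _ hk0]
    · have hx1 : O.valuation (residue w ⟨x, hxw⟩) < 1 := (hmax ⟨x, hxw⟩).1 hx
      obtain ⟨f, hf, hfx⟩ := (hsig _ (hne σ hσ)).ge ⟨_, hx1, rfl⟩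
      obtain ⟨f, rfl⟩ := residue_surjective f
      obtain ⟨g, hg, hgres⟩ := hdiv σ f hf
      refine ⟨f, fun h0 => hf ?_, ?_⟩
      · rw [show f = 0 from Subtype.ext h0, map_zero]
      · rw [← hg]
        rw [← hgres, ← hxres] at hfx
        have hx0' : residue W ⟨algebraMap K L x, (h.mem_iff x).2 hxw⟩ ≠ 0 := by
          rw [hxres]
          simpa using hx0
        have hg0 : residue W g ≠ 0 := fun h0 => hx0' (by
          rw [h0, map_zero, map_eq_zero] at hfx
          exact hfx)
        exact (compose_valuation_eq_iff ⟨algebraMap K L x, (h.mem_iff x).2 hxw⟩ g hx0' hg0).2 hfx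

end Lift

/-! ### Artin–Schreier generators -/

section ArtinSchreier

/-- After expanding the powers, only the term without `x` survives: the sums of the `m`-th powers of
the elements of `𝔽_p` vanish for `m < p - 1`. -/
theorem sum_range_add_pow {p : ℕ} [hp : Fact p.Prime] {k : Type*} [Field k] [CharP k p] (x : k) :
    ∑ i ∈ Finset.range p, (x + (i : k)) ^ (p - 1) = -1 := by
  have hpos : 0 < p - 1 := Nat.sub_pos_of_lt hp.out.one_lt
  have hcast : ∀ m : ℕ, ∑ i ∈ Finset.range p, (i : k) ^ m =
      ZMod.castHom dvd_rfl k (∑ a : ZMod p, a ^ m) := by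
    intro m
    rw [map_sum]
    refine Finset.sum_nbij' (fun i => (i : ZMod p)) ZMod.val (fun _ _ => Finset.mem_univ _)
      (fun a _ => Finset.mem_range.2 a.val_lt)
      (fun i hi => ZMod.val_cast_of_lt (Finset.mem_range.1 hi)) (fun a _ => ZMod.natCast_zmod_val a)
      (fun i _ => by simp)
  have hlt : ∀ m < p - 1, ∑ i ∈ Finset.range p, (i : k) ^ m = 0 := fun m hm => by
    rw [hcast, FiniteField.sum_pow_lt_card_sub_one (ZMod p) m (by rwa [ZMod.card]), map_zero]
  have htop : ∑ i ∈ Finset.range p, (i : k) ^ (p - 1) = -1 := by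
    rw [hcast, ← Finset.sum_erase_add _ _ (Finset.mem_univ (0 : ZMod p)), zero_pow hpos.ne',
      add_zero, Finset.sum_congr rfl fun a ha => ZMod.pow_card_sub_one_eq_one
        (Finset.ne_of_mem_erase ha), Finset.sum_const, Finset.card_erase_of_mem (Finset.mem_univ _),
      Finset.card_univ, ZMod.card, nsmul_eq_mul, mul_one, Nat.cast_sub hp.out.one_le]
    simp
  simp only [add_pow]
  rw [Finset.sum_comm, Finset.sum_eq_single_of_mem 0 (by simp)]
  · simpa using htop
  · intro m hm hm0
    have : p - 1 - m < p - 1 := Nat.sub_lt hpos (Nat.pos_of_ne_zero hm0)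
    rw [← Finset.sum_mul, ← Finset.mul_sum, hlt _ this, mul_zero, zero_mul]

theorem pow_artinSchreier {K L : Type*} [Field K] [Field L] [Algebra K L] {σ : L ≃ₐ[K] L}
    {β : L} (hβ : σ β = β + 1) (n : ℕ) :
    (σ ^ n) β = β + n := by
  induction n with
  | zero => simp
  | succ n ih =>
    rw [pow_succ', AlgEquiv.mul_apply, ih, map_add, hβ, map_natCast]
    push_cast
    ring

/-- The explicit solution of `σ β = β + 1` obtained from an element of nonzero trace. -/
theorem artinSchreier_of_trace {K L : Type*} [Field K] [Field L] [Algebra K L]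
    [FiniteDimensional K L] [IsGalois K L] {p : ℕ} [CharP K p] (hdeg : Module.finrank K L = p)
    (σ : L ≃ₐ[K] L) (x : L) (hx : ∑ i ∈ Finset.range p, (σ ^ i) x ≠ 0) :
    σ (-(∑ i ∈ Finset.range p, (i : L) * (σ ^ i) x) / ∑ i ∈ Finset.range p, (σ ^ i) x) =
      -(∑ i ∈ Finset.range p, (i : L) * (σ ^ i) x) / (∑ i ∈ Finset.range p, (σ ^ i) x) + 1 := by
  have : CharP L p := charP_of_injective_algebraMap (algebraMap K L).injective p
  have hp1 : σ ^ p = 1 := by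
    rw [← hdeg, ← IsGalois.card_aut_eq_finrank]
    exact pow_card_eq_one'
  have h1 : σ (∑ i ∈ Finset.range p, (σ ^ i) x) = ∑ i ∈ Finset.range p, (σ ^ i) x := by
    have h2 := Finset.sum_range_succ (fun i => (σ ^ i) x) p
    rw [Finset.sum_range_succ', hp1, pow_zero, add_left_inj] at h2
    rw [map_sum, ← h2]
    exact Finset.sum_congr rfl fun i _ => by rw [pow_succ', AlgEquiv.mul_apply]
  have h3 : σ (∑ i ∈ Finset.range p, (i : L) * (σ ^ i) x) =
      (∑ i ∈ Finset.range p, (i : L) * (σ ^ i) x) - ∑ i ∈ Finset.range p, (σ ^ i) x := by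
    have h2 := Finset.sum_range_succ (fun i => (i : L) * (σ ^ i) x) p
    rw [Finset.sum_range_succ', CharP.cast_eq_zero L p, zero_mul, add_zero, Nat.cast_zero, zero_mul,
      add_zero] at h2
    conv_rhs => rw [← h2, ← h1]
    rw [map_sum, map_sum, ← Finset.sum_sub_distrib]
    refine Finset.sum_congr rfl fun i _ => ?_
    rw [map_mul, map_natCast, pow_succ', AlgEquiv.mul_apply]
    push_cast
    ring
  rw [map_div₀, map_neg, h1, h3]
  field_simp
  ring

variable {K L : Type u} [Field K] [Field L] [Algebra K L] [FiniteDimensional K L] [IsGalois K L]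
  {p : ℕ} [hp : Fact p.Prime]


theorem iterate_sub_one_eq_zero [CharP K p] (hdeg : Module.finrank K L = p) (σ : L ≃ₐ[K] L) :
    (σ.toLinearMap - 1 : Module.End K L) ^ p = 0 := by
  have : CharP (Module.End K L) p :=
    charP_of_injective_algebraMap (algebraMap K (Module.End K L)).injective p
  rw [sub_pow_char_of_commute _ (Commute.one_right _), one_pow, sub_eq_zero]
  have hpow : ∀ n : ℕ, (σ.toLinearMap : Module.End K L) ^ n = (σ ^ n).toLinearMap := by
    intro n
    induction n with
    | zero => rfl
    | succ n ih => rw [pow_succ, ih, pow_succ]; rfl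
  have h1 : σ ^ p = 1 := by
    rw [← hdeg, ← IsGalois.card_aut_eq_finrank]
    exact pow_card_eq_one'
  rw [hpow, h1]
  rfl

/-- Existence of an Artin–Schreier generator, from the nilpotency of `σ - 1`. -/
theorem exists_artinSchreier [CharP K p] (hdeg : Module.finrank K L = p) {σ : L ≃ₐ[K] L}
    (hσ : σ ≠ 1) : ∃ β : L, σ β = β + 1 := by
  classical
  set D : Module.End K L := σ.toLinearMap - 1 with hD
  have hDapply : ∀ x, D x = σ x - x := fun x => rfl
  have hex : ∃ n, D ^ n = 0 := ⟨p, iterate_sub_one_eq_zero hdeg σ⟩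
  have hn := Nat.find_spec hex
  have hmin : ∀ m < Nat.find hex, D ^ m ≠ 0 := fun m hm => Nat.find_min hex hm
  set n := Nat.find hex
  have hn2 : 2 ≤ n := by
    by_contra! hlt
    interval_cases n
    · rw [pow_zero] at hn
      exact one_ne_zero hn
    · rw [pow_one] at hn
      refine hσ (AlgEquiv.ext fun x => ?_)
      have := LinearMap.congr_fun hn x
      rw [hDapply, LinearMap.zero_apply, sub_eq_zero] at this
      exact this
  obtain ⟨m, hm⟩ := Nat.exists_eq_add_of_le' hn2
  obtain ⟨z, hz⟩ : ∃ z, (D ^ (m + 1)) z ≠ 0 := by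
    by_contra! hcon
    exact hmin (m + 1) (by omega) (LinearMap.ext hcon)
  set c := (D ^ (m + 1)) z with hc
  have hfix : σ c = c := by
    rw [← sub_eq_zero, ← hDapply, hc, ← Module.End.mul_apply, ← pow_succ']
    rw [show m + 1 + 1 = n from hm.symm, hn, LinearMap.zero_apply]
  have hu : σ ((D ^ m) z) = (D ^ m) z + c := by
    rw [hc, pow_succ', Module.End.mul_apply, hDapply, add_sub_cancel]
  refine ⟨(D ^ m) z / c, ?_⟩
  rw [map_div₀, hu, hfix, add_div, div_self hz]

theorem exists_natCast_artinSchreier [CharP K p] (hdeg : Module.finrank K L = p) {σ : L ≃ₐ[K] L}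
    (hσ : σ ≠ 1) {β : L} (hβ : σ β = β + 1) {τ : L ≃ₐ[K] L} (hτ : τ ≠ 1) :
    ∃ n : ℕ, (n : K) ≠ 0 ∧ τ β = β + n := by
  obtain ⟨n, rfl⟩ := exists_pow_eq_of_finrank_prime hp.out hdeg hσ τ
  refine ⟨n, fun h0 => hτ ?_, pow_artinSchreier hβ n⟩
  obtain ⟨m, rfl⟩ := (CharP.cast_eq_zero_iff K p n).1 h0
  have h1 : σ ^ p = 1 := by
    rw [← hdeg, ← IsGalois.card_aut_eq_finrank]
    exact pow_card_eq_one'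
  rw [pow_mul, h1, one_pow]

theorem mem_range_of_fixed (hdeg : Module.finrank K L = p) {σ : L ≃ₐ[K] L} (hσ : σ ≠ 1) {x : L}
    (hx : σ x = x) : ∃ c : K, algebraMap K L c = x := by
  refine IntermediateField.mem_bot.1 ((IsGalois.mem_bot_iff_fixed x).2 fun τ => ?_)
  obtain ⟨n, rfl⟩ := exists_pow_eq_of_finrank_prime hp.out hdeg hσ τ
  induction n with
  | zero => rfl
  | succ n ih => rw [pow_succ', AlgEquiv.mul_apply, ih, hx]

end ArtinSchreier

/-! ### Independent defect over perfect fields -/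

section Perfect

variable {K L : Type u} [Field K] [Field L] [Algebra K L] [FiniteDimensional K L] [IsGalois K L]
  {p : ℕ} [hp : Fact p.Prime] [CharP K p] {v : ValuationSubring K} {V : ValuationSubring L}

/-- An Artin–Schreier generator of a defect extension has no translate in the valuation ring: such a
translate would be moved by the Galois group modulo the maximal ideal. -/
theorem one_lt_valuation_of_defect (hdeg : Module.finrank K L = p) (h : IsExtension v V)
    (hV : ∀ (σ : L ≃ₐ[K] L) (x : L), σ x ∈ V ↔ x ∈ V) (hdef : ¬ IsDefectlessExtension h)
    {σ : L ≃ₐ[K] L} (hσ : σ ≠ 1) {β : L} (hβ : σ β = β + 1) (c : K) :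
    1 < V.valuation (β - algebraMap K L c) := by
  by_contra! hle
  rw [V.valuation_le_one_iff] at hle
  let := (residueMap h).toAlgebra
  have hpos := residueDegree_pos h
  rw [residueDegree_eq_finrank h rfl] at hpos
  have : FiniteDimensional (ResidueField v) (ResidueField V) := Module.finite_of_finrank_pos hpos
  refine hdef (isDefectlessExtension_of_le_residueDegree h ?_)
  rw [residueDegree_eq_finrank h rfl, ← IsGalois.card_aut_eq_finrank]
  refine (Nat.card_le_card_of_injective _ (residueEquiv_injective h rfl hV fun τ hτ h1 => ?_)).trans
    (by rw [Nat.card_eq_fintype_card]; exact AlgEquiv.card_le)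
  obtain ⟨n, hn, hτβ⟩ := exists_natCast_artinSchreier (p := p) hdeg hσ hβ hτ
  have hmove : residueEquiv h rfl hV τ (residue V ⟨_, hle⟩) = residue V ⟨_, hle⟩ + (n : _) := by
    rw [residueEquiv_residue, ← map_natCast (residue V), ← map_add]
    refine congrArg _ (Subtype.ext ?_)
    change τ (β - algebraMap K L c) = β - algebraMap K L c + ((n : V) : L)
    rw [map_sub, hτβ, AlgEquiv.commutes]
    push_cast
    ring
  rw [h1, AlgEquiv.one_apply, left_eq_add] at hmove
  -- a natural number which is nonzero in `K` is invertible in the residue field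
  have : CharP (ResidueField V) p := by
    refine ringChar.of_eq (CharP.ringChar_of_prime_eq_zero hp.out ?_)
    rw [← map_natCast (residue V), show ((p : V)) = 0 from Subtype.ext (by
      push_cast
      rw [← map_natCast (algebraMap K L), CharP.cast_eq_zero, map_zero]), map_zero]
  exact hn ((CharP.cast_eq_zero_iff K p n).2
    ((CharP.cast_eq_zero_iff (ResidueField V) p n).1 hmove))

/-- For an Artin–Schreier generator `β` over a perfect field, the elements whose absolute value is
less than all distances from `β` to the ground field form a valuation ring: the set of these
distances is closed under taking `p`-th roots. -/
def distanceRing (hp2 : 2 ≤ p) (V : ValuationSubring L) (β : L)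
    (hone : ∀ c : K, 1 < V.valuation (β - algebraMap K L c))
    (hroot : ∀ c : K, ∃ d : K, (β - algebraMap K L d) ^ p = β - algebraMap K L c) :
    ValuationSubring L where
  carrier := {x | ∀ c : K, V.valuation x < V.valuation (β - algebraMap K L c)}
  zero_mem' c := by rw [map_zero]; exact zero_lt_one.trans (hone c)
  one_mem' c := by rw [map_one]; exact hone c
  add_mem' hx hy c := V.valuation.map_add_lt (hx c) (hy c)
  neg_mem' hx c := by rw [Valuation.map_neg]; exact hx c
  mul_mem' := by
    intro x y hx hy c
    obtain ⟨d, hd⟩ := hroot c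
    have hm : max 1 (max (V.valuation x) (V.valuation y)) < V.valuation (β - algebraMap K L d) :=
      max_lt (hone d) (max_lt (hx d) (hy d))
    rw [← hd, map_mul, map_pow]
    calc V.valuation x * V.valuation y
        ≤ max 1 (max (V.valuation x) (V.valuation y)) *
            max 1 (max (V.valuation x) (V.valuation y)) :=
          mul_le_mul' ((le_max_left _ _).trans (le_max_right _ _))
            ((le_max_right _ _).trans (le_max_right _ _))
      _ = max 1 (max (V.valuation x) (V.valuation y)) ^ 2 := (sq _).symm
      _ ≤ max 1 (max (V.valuation x) (V.valuation y)) ^ p :=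
          pow_le_pow_right₀ (le_max_left _ _) hp2
      _ < V.valuation (β - algebraMap K L d) ^ p :=
          pow_lt_pow_left₀ hm zero_le (by omega)
  mem_or_inv_mem' := by
    intro x
    rcases V.mem_or_inv_mem x with h | h
    · exact Or.inl fun c => ((V.valuation_le_one_iff x).2 h).trans_lt (hone c)
    · exact Or.inr fun c => ((V.valuation_le_one_iff _).2 h).trans_lt (hone c)

/-- If no translate of `β` by an element of `K` lies in `𝒪`, then no `y ∈ 𝒪` satisfies
`σ y ≡ y + 1`.  Otherwise the trace of `y ^ (p - 1)` is `≡ -1`, hence a unit, and the explicit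
solution of `σ β' = β' + 1` built from it lies in `𝒪` and differs from `β` by an element of `K`. -/
theorem artinSchreier_residue_false (hdeg : Module.finrank K L = p) {σ : L ≃ₐ[K] L} (hσ : σ ≠ 1)
    {β : L} (hβ : σ β = β + 1) (O : ValuationSubring L) (hO : ∀ (τ : L ≃ₐ[K] L) (x : L),
      O.valuation (τ x) = O.valuation x) (hβO : ∀ c : K, β - algebraMap K L c ∉ O) (y : L)
    (hy : y ∈ O) (hσy : O.valuation (σ y - y - 1) < 1) : False := by
  have hOmem : ∀ (τ : L ≃ₐ[K] L) (x : L), τ x ∈ O ↔ x ∈ O := fun τ x => by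
    rw [← O.valuation_le_one_iff, hO, O.valuation_le_one_iff]
  have : CharP L p := charP_of_injective_algebraMap (algebraMap K L).injective p
  have : CharP (ResidueField O) p := by
    refine ringChar.of_eq (CharP.ringChar_of_prime_eq_zero hp.out ?_)
    rw [← map_natCast (residue O), show ((p : O)) = 0 from Subtype.ext (by
      push_cast
      rw [CharP.cast_eq_zero]), map_zero]
  have hyn : ∀ n : ℕ, O.valuation ((σ ^ n) y - y - n) < 1 := by
    intro n
    induction n with
    | zero => simp
    | succ n ih =>
      have e : (σ ^ (n + 1)) y - y - ((n + 1 : ℕ) : L) =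
          (σ ^ n) (σ y - y - 1) + ((σ ^ n) y - y - n) := by
        rw [pow_succ, AlgEquiv.mul_apply]
        simp only [map_sub, map_one]
        push_cast
        ring
      rw [e]
      exact O.valuation.map_add_lt (by rwa [hO]) ih
  let Y : O := ⟨y, hy⟩
  have hres : ∀ n : ℕ, residue O (integerEquiv hOmem (σ ^ n) Y) = residue O Y + n := by
    intro n
    rw [← map_natCast (residue O), ← map_add, ← sub_eq_zero, ← map_sub,
      residue_eq_zero_iff_valuation]
    convert hyn n using 2
    change (σ ^ n) y - (y + ((n : O) : L)) = _
    push_cast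
    ring
  let T : O := ∑ i ∈ Finset.range p, integerEquiv hOmem (σ ^ i) Y ^ (p - 1)
  have hT : (T : L) = ∑ i ∈ Finset.range p, (σ ^ i) (y ^ (p - 1)) := by
    rw [← ValuationSubring.subtype_apply, map_sum]
    refine Finset.sum_congr rfl fun i _ => ?_
    rw [map_pow, map_pow]
    rfl
  have hTres : residue O T = -1 := by
    rw [map_sum, ← sum_range_add_pow (residue O Y)]
    exact Finset.sum_congr rfl fun i _ => by rw [map_pow, hres]
  have hTval : O.valuation (T : L) = 1 := (residue_ne_zero_iff_valuation T).1 (by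
    rw [hTres]; exact neg_ne_zero.2 one_ne_zero)
  have hT0 : ∑ i ∈ Finset.range p, (σ ^ i) (y ^ (p - 1)) ≠ 0 := by
    rw [← hT]
    intro h0
    rw [h0, map_zero] at hTval
    exact zero_ne_one hTval
  have hsol := artinSchreier_of_trace hdeg σ (y ^ (p - 1)) hT0
  set β' := -(∑ i ∈ Finset.range p, (i : L) * (σ ^ i) (y ^ (p - 1))) /
    ∑ i ∈ Finset.range p, (σ ^ i) (y ^ (p - 1)) with hβ'
  have hβ'O : β' ∈ O := by
    rw [← O.valuation_le_one_iff, hβ', map_div₀, ← hT, hTval, div_one, Valuation.map_neg]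
    refine O.valuation.map_sum_le fun i _ => ?_
    rw [map_mul, hO]
    refine mul_le_one' ?_ ?_
    · exact (O.valuation_le_one_iff _).2 (natCast_mem O i)
    · rw [map_pow]
      exact pow_le_one₀ zero_le ((O.valuation_le_one_iff y).2 hy)
  obtain ⟨c, hc⟩ := mem_range_of_fixed hdeg hσ (x := β - β') (by
    rw [map_sub, hβ, hsol]
    ring)
  refine hβO c ?_
  rwa [hc, sub_sub_cancel]

/-- The quotients `(σ f - f) / f` lie in the maximal ideal of `𝒪`, for any Galois-invariant coarser
valuation ring `𝒪` which contains no translate of `β`.  Otherwise, applying `σ - 1` repeatedly, one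
finds a counterexample `f` for which `g = σ f - f` is not one, and then `y = f / g` contradicts
`artinSchreier_residue_false`. -/
theorem valuation_sub_div_lt_one (hdeg : Module.finrank K L = p) {σ : L ≃ₐ[K] L} (hσ : σ ≠ 1)
    {β : L} (hβ : σ β = β + 1) (O : ValuationSubring L) (hO : ∀ (τ : L ≃ₐ[K] L) (x : L),
      O.valuation (τ x) = O.valuation x) (hβO : ∀ c : K, β - algebraMap K L c ∉ O) (f : L)
    (hf : f ≠ 0) : O.valuation ((σ f - f) / f) < 1 := by
  have hnil : ∃ n : ℕ, ((σ.toLinearMap - 1 : Module.End K L) ^ n) f = 0 :=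
    ⟨p, by rw [iterate_sub_one_eq_zero hdeg, LinearMap.zero_apply]⟩
  obtain ⟨n, hn⟩ := hnil
  induction n generalizing f with
  | zero => exact absurd hn hf
  | succ n ih =>
    by_contra! hge
    set g := σ f - f with hg
    have hg0 : g ≠ 0 := by
      intro h0
      rw [h0, zero_div, map_zero] at hge
      exact hge.not_gt zero_lt_one
    have hη := ih g hg0 (by rwa [pow_succ, Module.End.mul_apply] at hn)
    set η := (σ g - g) / g with hη_def
    have hσg : σ g = g * (1 + η) := by
      rw [hη_def]
      field_simp
      ring
    have h1η : O.valuation (1 + η) = 1 := O.valuation.map_one_add_of_lt hη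
    have h1η0 : 1 + η ≠ 0 := fun h0 => by
      rw [h0, map_zero] at h1η
      exact zero_ne_one h1η
    have hy : O.valuation (f / g) ≤ 1 := by
      rw [O.valuation.one_le_val_iff (div_ne_zero hg0 hf), inv_div] at hge
      exact hge
    refine artinSchreier_residue_false hdeg hσ hβ O hO hβO (f / g)
      ((O.valuation_le_one_iff _).1 hy) ?_
    have hσf : σ f = f + g := by rw [hg]; ring
    have e : σ (f / g) - f / g - 1 = -((f / g + 1) * η) / (1 + η) := by
      rw [map_div₀, hσf, hσg]
      field_simp
      ring
    rw [e, map_div₀, h1η, div_one, Valuation.map_neg, map_mul]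
    refine (mul_le_of_le_one_left' ?_).trans_lt hη
    exact O.valuation.map_add_le hy (by rw [map_one])

/-- Over a perfect field of characteristic `p`, all Galois defect extensions of degree `p` have
independent defect. -/
theorem hasIndependentDefect_of_perfect [PerfectField K] (hdeg : Module.finrank K L = p)
    (h : IsExtension v V) (hV : ∀ (σ : L ≃ₐ[K] L) (x : L), σ x ∈ V ↔ x ∈ V)
    (hdef : ¬ IsDefectlessExtension h) : HasIndependentDefect v V := by
  have hchar : CharP L p := charP_of_injective_algebraMap (algebraMap K L).injective p
  have := PerfectField.toPerfectRing (K := K) p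
  have hram := exists_valuation_eq_of_defect hp.out hdeg h hV hdef
  obtain ⟨σ, hσ⟩ : ∃ σ : L ≃ₐ[K] L, σ ≠ 1 := by
    by_contra! hcon
    have h1 : Nat.card (L ≃ₐ[K] L) = 1 :=
      Nat.card_eq_one_iff_unique.2 ⟨⟨fun a b => (hcon a).trans (hcon b).symm⟩, ⟨1⟩⟩
    rw [IsGalois.card_aut_eq_finrank, hdeg] at h1
    exact hp.out.one_lt.ne' h1
  obtain ⟨β, hβ⟩ := exists_artinSchreier hdeg hσ
  have hone := one_lt_valuation_of_defect hdeg h hV hdef hσ hβ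
  have hroot : ∀ c : K, ∃ d : K, (β - algebraMap K L d) ^ p = β - algebraMap K L c := by
    intro c
    obtain ⟨a, ha⟩ := mem_range_of_fixed hdeg hσ (x := β ^ p - β) (by
      rw [map_sub, map_pow, hβ, add_pow_char, one_pow]
      ring)
    obtain ⟨d, hd⟩ := (bijective_frobenius K p).2 (a + c)
    rw [frobenius_def] at hd
    refine ⟨d, ?_⟩
    rw [sub_pow_char, ← map_pow, hd, map_add, ha]
    ring
  let O := distanceRing hp.out.two_le V β hone hroot
  have hmemO : ∀ x : L, x ∈ O ↔ ∀ c : K, V.valuation x < V.valuation (β - algebraMap K L c) :=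
    fun x => Iff.rfl
  have hVO : V ≤ O := fun x hx c => ((V.valuation_le_one_iff x).2 hx).trans_lt (hone c)
  have hO : ∀ (τ : L ≃ₐ[K] L) (x : L), O.valuation (τ x) = O.valuation x := fun τ x =>
    valuation_eq_of_le hVO (valuation_algEquiv_apply V hV τ x)
  have hext : IsExtension (O.comap (algebraMap K L)) O := rfl
  rw [hasIndependentDefect_iff]
  refine ⟨O.comap (algebraMap K L), fun x hx => hVO ((h.mem_iff x).2 hx), fun htop => ?_,
    fun x hx0 hx => ?_, fun τ hτ => Set.Subset.antisymm ?_ ?_⟩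
  · obtain ⟨k, hk⟩ := hram β
    have : k ∈ O.comap (algebraMap K L) := htop ▸ ValuationSubring.mem_top k
    have h1 := (hmemO _).1 this 0
    rw [map_zero, sub_zero, hk] at h1
    exact lt_irrefl _ h1
  · -- a `p`-th root of `x` has too large a value to be a multiple of `x`
    obtain ⟨y, rfl⟩ := (bijective_frobenius K p).2 x
    rw [frobenius_def] at hx hx0 ⊢
    have hy0 : y ≠ 0 := fun h0 => hx0 (by rw [h0, zero_pow hp.out.ne_zero])
    rw [map_pow] at hx
    have hy : (O.comap (algebraMap K L)).valuation y < 1 := by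
      by_contra! hge
      exact (one_le_pow₀ hge).not_gt hx
    refine ⟨y, hy, fun hmem => ?_⟩
    rw [← ValuationSubring.valuation_le_one_iff, map_div₀, map_pow,
      div_le_one₀ (pow_pos (Valuation.pos_iff _ |>.2 hy0) _)] at hmem
    exact hmem.not_gt (pow_lt_self_of_lt_one₀ (Valuation.pos_iff _ |>.2 hy0) hy hp.out.one_lt)
  all_goals
    obtain ⟨n, hn, hτβ⟩ := exists_natCast_artinSchreier (p := p) hdeg hσ hβ hτ
    have hn0 : (n : L) ≠ 0 := by
      rw [← map_natCast (algebraMap K L)]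
      exact (map_ne_zero _).2 hn
    have hnval : V.valuation (n : L) = 1 := by
      have h1 : V.valuation (n : L) ^ p = V.valuation (n : L) := by
        rw [← map_pow, ← frobenius_def, map_natCast]
      have hpos : 0 < V.valuation (n : L) := V.valuation.pos_iff.2 hn0
      rcases lt_trichotomy (V.valuation (n : L)) 1 with h2 | h2 | h2
      · exact absurd h1 (pow_lt_self_of_lt_one₀ hpos h2 hp.out.one_lt).ne
      · exact h2
      · exact absurd h1 (lt_self_pow₀ h2 hp.out.one_lt).ne'
    have hτβ' : ∀ c : K, τ (β - algebraMap K L c) - (β - algebraMap K L c) = n := fun c => by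
      rw [map_sub, hτβ, AlgEquiv.commutes]
      ring
  · rintro α ⟨f, hf, rfl⟩
    have hβn : τ (β / n) = β / n + 1 := by
      rw [map_div₀, hτβ, map_natCast, add_div, div_self hn0]
    obtain ⟨k, hk⟩ := hram ((τ f - f) / f)
    refine ⟨k, ?_, hk⟩
    rw [← hext.valuation_lt_one_iff, ← valuation_eq_of_le hVO hk]
    refine valuation_sub_div_lt_one hdeg hτ hβn O hO (fun c hc => ?_) f hf
    have h1 := (hmemO _).1 hc (n * c)
    have e : β - algebraMap K L (n * c) = n * (β / n - algebraMap K L c) := by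
      rw [map_mul, map_natCast]
      field_simp
    rw [e, map_mul, hnval, one_mul] at h1
    exact lt_irrefl _ h1
  · rintro α ⟨x, hx, rfl⟩
    by_cases hx0 : x = 0
    · exact ⟨1, one_ne_zero, by simp [hx0]⟩
    have hxL : algebraMap K L x ≠ 0 := (map_ne_zero _).2 hx0
    rw [← hext.valuation_lt_one_iff, valuation_lt_one_iff_or] at hx
    have hx' := hx.resolve_left hxL
    rw [hmemO] at hx'
    push Not at hx'
    obtain ⟨c, hc⟩ := hx'
    -- a translate of `β` whose value is opposite to that of `x`
    obtain ⟨d, hd⟩ : ∃ d : K, V.valuation (β - algebraMap K L d) =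
        V.valuation (algebraMap K L x)⁻¹ := by
      rcases hc.lt_or_eq with hlt | heq
      · refine ⟨c + x⁻¹, ?_⟩
        rw [map_add, map_inv₀ (algebraMap K L), ← sub_sub]
        exact V.valuation.map_sub_eq_of_lt_right hlt
      · exact ⟨c, heq⟩
    refine ⟨β - algebraMap K L d, fun h0 => ?_, ?_⟩
    · rw [h0, map_zero] at hd
      exact (V.valuation.ne_zero_iff.2 (inv_ne_zero hxL)) hd.symm
    · rw [hτβ', map_div₀, hnval, hd, map_inv₀, one_div, inv_inv]

end Perfect

/-! ### Defect extensions for a composite valuation -/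

section Residue

variable {K : Type u} [Field K] {w : ValuationSubring K} {vbar : ValuationSubring (ResidueField w)}

theorem exists_residueField_compose_equiv :
    ∃ e : ResidueField (compose w vbar) ≃+* ResidueField vbar, ∀ x : compose w vbar,
      e (residue (compose w vbar) x) = residue vbar
        ⟨residue w ⟨(x : K), compose_le x.2⟩,
          (coe_mem_compose_iff (⟨(x : K), compose_le x.2⟩ : w)).1 x.2⟩ := by
  let φ : compose w vbar →+* vbar :=
    ((residue w).comp (ValuationSubring.inclusion _ w compose_le)).codRestrict vbar.toSubring
      fun x => (coe_mem_compose_iff (⟨(x : K), compose_le x.2⟩ : w)).1 x.2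
  let f := (residue vbar).comp φ
  have hf : IsLocalHom f := by
    refine ⟨fun x hx => ?_⟩
    by_contra hnu
    have h1 := (compose_valuation_lt_one_iff (⟨(x : K), compose_le x.2⟩ : w)).1
      (((compose w vbar).valuation_lt_one_iff x).1 ((mem_maximalIdeal x).2 hnu))
    exact hx.ne_zero ((residue_eq_zero_iff_valuation _).2 h1)
  refine ⟨RingEquiv.ofBijective (ResidueField.lift f) ⟨(ResidueField.lift f).injective, ?_⟩,
    fun x => rfl⟩
  intro y
  obtain ⟨⟨y, hy⟩, rfl⟩ := residue_surjective y
  obtain ⟨x, rfl⟩ := residue_surjective y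
  exact ⟨residue _ ⟨x, (coe_mem_compose_iff x).2 hy⟩, rfl⟩

theorem residueDegree_compose {L : Type u} [Field L] [Algebra K L] {W : ValuationSubring L}
    {Vbar : ValuationSubring (ResidueField W)} (h : IsExtension w W)
    [Algebra (ResidueField w) (ResidueField W)]
    (halg : algebraMap (ResidueField w) (ResidueField W) = residueMap h)
    (hE : IsExtension (compose w vbar) (compose W Vbar)) (hbar : IsExtension vbar Vbar) :
    residueDegree hE = residueDegree hbar := by
  let := (residueMap hE).toAlgebra
  let := (residueMap hbar).toAlgebra
  rw [residueDegree_eq_finrank hE rfl, residueDegree_eq_finrank hbar rfl]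
  obtain ⟨e, he⟩ := exists_residueField_compose_equiv (w := w) (vbar := vbar)
  obtain ⟨e', he'⟩ := exists_residueField_compose_equiv (w := W) (vbar := Vbar)
  refine Algebra.finrank_eq_of_equiv_equiv e e' (RingHom.ext fun y => ?_)
  obtain ⟨x, rfl⟩ := residue_surjective y
  change residueMap hbar (e (residue _ x)) = e' (residueMap hE (residue _ x))
  rw [he, residueMap_residue, residueMap_residue, he']
  refine congrArg _ (Subtype.ext ?_)
  change algebraMap (ResidueField w) (ResidueField W) (residue w _) = _
  rw [halg, residueMap_residue]

end Residue

/-- Independence of the Galois defect extensions of degree `p` passes from the residue field of a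
defectless valuation with perfect residue field to the composite valuation.  A defect extension of
prime degree does not extend the value group, so that the coarser valuation, being defectless, has
a residue field extension of degree `p`, which is a Galois defect extension. -/
theorem AllGaloisDefectIndependent.compose {K : Type u} [Field K] {w : ValuationSubring K}
    {vbar : ValuationSubring (ResidueField w)} {p : ℕ} (hp : p.Prime) (hw : IsDefectless w)
    [PerfectField (ResidueField w)]
    (hstab : ∀ (L : Type u) [Field L] [Algebra K L] [FiniteDimensional K L] [IsGalois K L]
      (V : ValuationSubring L), IsExtension (compose w vbar) V →
        ∀ (σ : L ≃ₐ[K] L) (x : L), σ x ∈ V ↔ x ∈ V)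
    (hbar : AllGaloisDefectIndependent p vbar) :
    AllGaloisDefectIndependent p (DefectLemma.compose w vbar) := by
  intro L _ _ _ _ V hE hdeg hdef
  have hV := hstab L V hE
  have hram := exists_valuation_eq_of_defect hp hdeg hE hV hdef
  have hVW := le_extendCoarsening w V
  have hWext := isExtension_extendCoarsening hE compose_le
  have hW := mem_extendCoarsening_algEquiv_iff w hV
  generalize extendCoarsening w V = W at hVW hWext hW
  obtain ⟨Vbar, rfl⟩ : ∃ Vbar, V = DefectLemma.compose W Vbar :=
    ⟨_, (compose_residueValuation hVW).symm⟩
  have heW : ramificationIndex K W = 1 := ramificationIndex_eq_one_iff.2 fun x => by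
    obtain ⟨k, hk⟩ := hram x
    exact ⟨k, valuation_eq_of_le hVW hk⟩
  have heV := ramificationIndex_eq_one_iff.2 hram
  let : Algebra (ResidueField w) (ResidueField W) := (residueMap hWext).toAlgebra
  have hf : Module.finrank (ResidueField w) (ResidueField W) = p := by
    have h1 : _ = _ := hw L W hWext
    rw [heW, one_mul, hdeg] at h1
    exact h1.symm
  have : FiniteDimensional (ResidueField w) (ResidueField W) :=
    Module.finite_of_finrank_pos (hf ▸ hp.pos)
  have hne := residueEquiv_ne_one hp hdeg hWext rfl hW hf
  have : IsGalois (ResidueField w) (ResidueField W) :=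
    isGalois_residueField hWext rfl hW (hf.trans hdeg.symm) hne
  have hbarE : IsExtension vbar Vbar := (isExtension_compose_iff hWext rfl).1 hE
  refine HasIndependentDefect.compose hWext rfl hbarE hW hne hram
    (hbar (ResidueField W) Vbar hbarE hf fun hdl => hdef ?_)
  have hebar : ramificationIndex (ResidueField w) Vbar = 1 :=
    ramificationIndex_eq_one_iff.2 fun y => by
      by_cases hy : y = 0
      · exact ⟨0, by simp [hy]⟩
      obtain ⟨x, rfl⟩ := residue_surjective y
      obtain ⟨k, hk⟩ := hram x
      have hk1 : W.valuation (algebraMap K L k) = 1 := by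
        rw [← valuation_eq_of_le hVW hk]
        exact (residue_ne_zero_iff_valuation x).1 hy
      have hkW := (W.valuation_le_one_iff _).1 hk1.le
      refine ⟨residue w ⟨k, (hWext.mem_iff k).1 hkW⟩, ?_⟩
      exact (compose_valuation_eq_iff x ⟨_, hkW⟩ hy ((residue_ne_zero_iff_valuation _).2 hk1)).1 hk
  have h1 : _ = _ := hdl
  rw [hebar, one_mul, hf] at h1
  change _ = _
  rw [heV, one_mul, residueDegree_compose hWext rfl hE hbarE, hdeg, h1]

/-- In an extension generated by a `p`-th root of unity with `p` invertible in the residue field,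
the residue field is generated by a `p`-th root of unity, provided that the residue degree is at
most the degree.  Indeed, the conjugates of the root of unity remain distinct in the residue
field. -/
theorem isCyclotomicExtension_residueField {K K' : Type u} [Field K] [Field K'] [Algebra K K']
    {p : ℕ} [hp : Fact p.Prime] [IsCyclotomicExtension {p} K K'] {w : ValuationSubring K}
    {w' : ValuationSubring K'} (h : IsExtension w w') [Algebra (ResidueField w) (ResidueField w')]
    [FiniteDimensional (ResidueField w) (ResidueField w')]
    (halg : algebraMap (ResidueField w) (ResidueField w') = residueMap h)
    (hw' : ∀ (σ : K' ≃ₐ[K] K') (x : K'), σ x ∈ w' ↔ x ∈ w') (hp0 : (p : ResidueField w) ≠ 0)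
    (hle : Module.finrank (ResidueField w) (ResidueField w') ≤ Module.finrank K K') :
    IsCyclotomicExtension {p} (ResidueField w) (ResidueField w') := by
  have := IsCyclotomicExtension.finiteDimensional {p} K K'
  have := IsCyclotomicExtension.isGalois {p} K K'
  have hζ := IsCyclotomicExtension.zeta_spec p K K'
  set ζ := IsCyclotomicExtension.zeta p K K'
  have hζw : ζ ∈ w' := by
    rw [← w'.valuation_le_one_iff]
    refine le_of_eq (pow_eq_one_iff_of_nonneg zero_le hp.out.ne_zero |>.1 ?_)
    rw [← map_pow, hζ.pow_eq_one, map_one]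
  let Z : w' := ⟨ζ, hζw⟩
  have hZp : Z ^ p = 1 := Subtype.ext hζ.pow_eq_one
  have hz1 : residue w' Z ≠ 1 := by
    intro h1
    have hsum : ∑ i ∈ Finset.range p, Z ^ i = 0 := by
      refine w'.subtype_injective ?_
      rw [map_sum, map_zero, ← hζ.geom_sum_eq_zero hp.out.one_lt]
      exact Finset.sum_congr rfl fun i _ => map_pow _ _ _
    have h2 := congrArg (residue w') hsum
    rw [map_sum, map_zero, Finset.sum_congr rfl fun i _ => by rw [map_pow, h1, one_pow]] at h2
    simp only [Finset.sum_const, Finset.card_range, nsmul_eq_mul, mul_one] at h2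
    rw [← map_natCast (algebraMap (ResidueField w) (ResidueField w')), map_eq_zero] at h2
    exact hp0 h2
  have hz : IsPrimitiveRoot (residue w' Z) p := by
    rw [IsPrimitiveRoot.iff_orderOf]
    refine orderOf_eq_prime ?_ hz1
    rw [← map_pow, hZp, map_one]
  rw [IsCyclotomicExtension.iff_singleton]
  refine ⟨⟨_, hz⟩, ?_⟩
  let M : Subalgebra (ResidueField w) (ResidueField w') :=
    Algebra.adjoin (ResidueField w) {residue w' Z}
  have hzM : residue w' Z ∈ M := Algebra.subset_adjoin rfl
  -- distinct automorphisms of `K'` restrict to distinct embeddings of the subextension `M`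
  let Φ : (K' ≃ₐ[K] K') → (M →ₐ[ResidueField w] ResidueField w') := fun σ =>
    (residueEquiv h halg hw' σ).toAlgHom.comp M.val
  have hΦ : Function.Injective Φ := by
    intro σ τ hστ
    have h1 : residueEquiv h halg hw' σ (residue w' Z) =
        residueEquiv h halg hw' τ (residue w' Z) := DFunLike.congr_fun hστ (⟨_, hzM⟩ : M)
    have hpow : ∀ ρ : K' ≃ₐ[K] K', ∃ i < p, ζ ^ i = ρ ζ := fun ρ =>
      hζ.eq_pow_of_pow_eq_one (by rw [← map_pow, hζ.pow_eq_one, map_one])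
    have hres : ∀ (ρ : K' ≃ₐ[K] K') (i : ℕ), ζ ^ i = ρ ζ →
        residueEquiv h halg hw' ρ (residue w' Z) = residue w' Z ^ i := fun ρ i hi => by
      rw [residueEquiv_residue, ← map_pow]
      exact congrArg _ (Subtype.ext hi.symm)
    obtain ⟨i, hi, hσ⟩ := hpow σ
    obtain ⟨j, hj, hτ⟩ := hpow τ
    rw [hres σ i hσ, hres τ j hτ] at h1
    have hij := hz.pow_inj hi hj h1
    have hζστ : σ ζ = τ ζ := by rw [← hσ, ← hτ, hij]
    refine AlgEquiv.coe_toAlgHom_injective ((hζ.powerBasis K).algHom_ext ?_)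
    rw [IsPrimitiveRoot.powerBasis_gen]
    exact hζστ
  have hcard : Module.finrank K K' ≤ Module.finrank (ResidueField w) M := by
    rw [← IsGalois.card_aut_eq_finrank]
    exact (Nat.card_le_card_of_injective Φ hΦ).trans (card_algHom_le_finrank _ _ _)
  have hM : Subalgebra.toSubmodule M = ⊤ :=
    Submodule.eq_top_of_finrank_eq (le_antisymm (Submodule.finrank_le _) (hle.trans hcard))
  intro x
  have hx : x ∈ M := by
    rw [← Subalgebra.mem_toSubmodule, hM]
    exact Submodule.mem_top
  refine Algebra.adjoin_mono ?_ hx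
  rintro _ rfl
  exact hz.pow_eq_one

/-- A perfect henselian field of characteristic `p` has, over any finite extension, only Galois
defect extensions of degree `p` with independent defect. -/
theorem allGaloisDefectIndependent_of_perfect {k k' : Type u} [Field k] [Field k'] [Algebra k k']
    [FiniteDimensional k k'] [PerfectField k] {p : ℕ} (hp : p.Prime) (hp0 : (p : k) = 0)
    {v : ValuationSubring k} {v' : ValuationSubring k'} (hv : HenselianLocalRing v)
    (h : IsExtension v v') : AllGaloisDefectIndependent p v' := by
  intro L _ _ _ _ V hV hdeg hdef
  let : Algebra k L := ((algebraMap k' L).comp (algebraMap k k')).toAlgebra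
  have : IsScalarTower k k' L := IsScalarTower.of_algebraMap_eq fun _ => rfl
  have : FiniteDimensional k L := FiniteDimensional.trans k k' L
  have : Fact p.Prime := ⟨hp⟩
  have : CharP k p := ringChar.of_eq (CharP.ringChar_of_prime_eq_zero hp hp0)
  have : CharP k' p := charP_of_injective_algebraMap (algebraMap k k').injective p
  have : PerfectField k' := Algebra.IsAlgebraic.perfectField k
  exact hasIndependentDefect_of_perfect hdeg hV
    (fun σ x => mem_iff_of_henselian hv (h.trans hV) (σ.restrictScalars k) x) hdef

/-- The reduction to the residue field of the coarser valuation, over a finite separable extension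
`K'` of the henselian field `K`. -/
theorem allGaloisDefectIndependent_of_residue {K K' : Type u} [Field K] [Field K'] [Algebra K K']
    [FiniteDimensional K K'] [Algebra.IsSeparable K K'] {w : ValuationSubring K}
    {vbar : ValuationSubring (ResidueField w)} (hv : HenselianLocalRing (compose w vbar))
    (hw : IsDefectless w) [PerfectField (ResidueField w)] {p : ℕ} (hp : p.Prime)
    {v' : ValuationSubring K'} (h : IsExtension (compose w vbar) v')
    (hbar : ∀ (w' : ValuationSubring K') (h' : IsExtension w w')
      (vbar' : ValuationSubring (ResidueField w')),
      letI : Algebra (ResidueField w) (ResidueField w') := (residueMap h').toAlgebra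
      FiniteDimensional (ResidueField w) (ResidueField w') →
      Module.finrank (ResidueField w) (ResidueField w') ≤ Module.finrank K K' →
      (∀ (σ : K' ≃ₐ[K] K') (x : K'), σ x ∈ w' ↔ x ∈ w') →
      IsExtension vbar vbar' → AllGaloisDefectIndependent p vbar') :
    AllGaloisDefectIndependent p v' := by
  have hle := le_extendCoarsening w v'
  have hext := isExtension_extendCoarsening h compose_le
  have hstab := mem_extendCoarsening_algEquiv_iff w (mem_iff_of_henselian hv h)
  generalize extendCoarsening w v' = w' at hle hext hstab
  obtain ⟨vbar', rfl⟩ : ∃ vbar', v' = compose w' vbar' :=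
    ⟨_, (compose_residueValuation hle).symm⟩
  let : Algebra (ResidueField w) (ResidueField w') := (residueMap hext).toAlgebra
  have hpos : 0 < Module.finrank (ResidueField w) (ResidueField w') := residueDegree_pos hext
  have hfin : FiniteDimensional (ResidueField w) (ResidueField w') :=
    Module.finite_of_finrank_pos hpos
  have : PerfectField (ResidueField w') := Algebra.IsAlgebraic.perfectField (ResidueField w)
  refine AllGaloisDefectIndependent.compose hp (hw.of_finite hext) ?_
    (hbar w' hext vbar' hfin ?_ hstab ((isExtension_compose_iff hext rfl).1 h))
  · intro L _ _ _ _ V hV σ x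
    let : Algebra K L := ((algebraMap K' L).comp (algebraMap K K')).toAlgebra
    have : IsScalarTower K K' L := IsScalarTower.of_algebraMap_eq fun _ => rfl
    have : FiniteDimensional K L := FiniteDimensional.trans K K' L
    have : Algebra.IsSeparable K L := Algebra.IsSeparable.trans K K' L
    exact mem_iff_of_henselian hv (h.trans hV) (σ.restrictScalars K) x
  · exact (Nat.le_mul_of_pos_left _ (ramificationIndex_pos hext)).trans
      (ramificationIndex_mul_residueDegree_le hext)

end DefectLemma

theorem mainTheorem6 {K : Type u} [Field K] (v w : ValuationSubring K)
    (vbar : ValuationSubring (IsLocalRing.ResidueField w))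
    (hv : HenselianLocalRing v)
    (hcomp : v = DefectLemma.compose w vbar)
    (hw : DefectLemma.IsDefectless w)
    (hperfect : PerfectField (IsLocalRing.ResidueField w))
    (hvbar : DefectLemma.IsIndependentDefectField vbar) :
    DefectLemma.IsIndependentDefectField v := by
  subst hcomp
  obtain ⟨e, -⟩ := DefectLemma.exists_residueField_compose_equiv (w := w) (vbar := vbar)
  have hchar : ringChar (IsLocalRing.ResidueField (DefectLemma.compose w vbar)) =
      ringChar (IsLocalRing.ResidueField vbar) :=
    ringChar.eq_iff.2 ((e : _ →+* _).charP_iff e.injective _ |>.2 (ringChar.charP _))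
  generalize hpdef : ringChar (IsLocalRing.ResidueField vbar) = p at hchar
  have hcharp : CharP (IsLocalRing.ResidueField vbar) p := hpdef ▸ ringChar.charP _
  have hp0 : p ≠ 0 := hpdef ▸ hvbar.residueChar_ne_zero
  have hp : p.Prime :=
    (CharP.char_is_prime_or_zero (IsLocalRing.ResidueField vbar) p).resolve_right hp0
  have : Fact p.Prime := ⟨hp⟩
  -- the only possible positive characteristic of a ring mapping to the residue field is `p`
  have hdown : ∀ q : ℕ, (q : IsLocalRing.ResidueField w) = 0 → p ∣ q := fun q hq => by
    rw [← CharP.cast_eq_zero_iff (IsLocalRing.ResidueField vbar) p,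
      ← map_natCast (IsLocalRing.residue vbar), show (q : vbar) = 0 from Subtype.ext (by
        push_cast
        exact hq), map_zero]
  refine ⟨hv, hchar ▸ hp0, fun hK0 K' _ _ hcyc v' hE => ?_, fun hK => ?_⟩
  · rw [hchar] at hcyc ⊢
    have := IsCyclotomicExtension.finiteDimensional {p} K K'
    have := IsCyclotomicExtension.isGalois {p} K K'
    refine DefectLemma.allGaloisDefectIndependent_of_residue hv hw hp hE ?_
    intro w' h' vbar'
    let : Algebra (IsLocalRing.ResidueField w) (IsLocalRing.ResidueField w') :=
      (DefectLemma.residueMap h').toAlgebra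
    intro hfin hle hstab hbar
    by_cases hpw : (p : IsLocalRing.ResidueField w) = 0
    · exact DefectLemma.allGaloisDefectIndependent_of_perfect hp hpw hvbar.henselian hbar
    · have hchar0 : ringChar (IsLocalRing.ResidueField w) = 0 := by
        have hcast := ringChar.Nat.cast_ringChar (R := IsLocalRing.ResidueField w)
        refine (CharP.char_is_prime_or_zero (IsLocalRing.ResidueField w) _).resolve_left
          fun hq => hpw ?_
        rw [(Nat.prime_dvd_prime_iff_eq hp hq).1 (hdown _ hcast)]
        exact hcast
      have hcyc' := DefectLemma.isCyclotomicExtension_residueField h' rfl hstab hpw hle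
      rw [← hpdef] at hcyc' ⊢
      exact hvbar.independent_of_char_zero hchar0 (IsLocalRing.ResidueField w') vbar' hbar
  · rw [hchar]
    have hpw : (p : IsLocalRing.ResidueField w) = 0 := by
      have hq := (CharP.char_is_prime_or_zero K (ringChar K)).resolve_right hK
      have hcast : ((ringChar K : ℕ) : IsLocalRing.ResidueField w) = 0 := by
        rw [← map_natCast (IsLocalRing.residue w), show ((ringChar K : ℕ) : w) = 0 from
          Subtype.ext (by push_cast; exact ringChar.Nat.cast_ringChar), map_zero]
      rw [(Nat.prime_dvd_prime_iff_eq hp hq).1 (hdown _ hcast)]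
      exact hcast
    refine DefectLemma.allGaloisDefectIndependent_of_residue (K' := K) hv hw hp rfl ?_
    intro w' h' vbar'
    let : Algebra (IsLocalRing.ResidueField w) (IsLocalRing.ResidueField w') :=
      (DefectLemma.residueMap h').toAlgebra
    intro hfin _ _ hbar
    exact DefectLemma.allGaloisDefectIndependent_of_perfect hp hpw hvbar.henselian hbar
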